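/- Setting. A network has a finite node set $V$, and all nodes know an upper bound $n\ge |V|$ on its size; the nodes have distinct integer identifiers. Communication is synchronous gossip: in each round a node contacts at most one neighbour and sends it one message. Let $S\subseteq V$ be nonempty and let $G'=(S,E')$ be a graph on $S$ (its edges may be peer-to-peer edges) that is a $d$-bounded-degree expander: it is connected, every degree is at most a constant $d\ge 1$ known to the nodes, and $|E'(A,S\setminus A)|\ge \varphi\min\{\mathrm{vol}(A),\mathrm{vol}(S\setminus A)\}$ for all $\emptyset\ne A\subsetneq S$, with a constant $\varphi>0$. Every $u\in S$ holds a sketch vector $s(u)\in\mathbb R^k$, with positive part $s^+(u)$ and negative part $s^-(u)$ (entries of the other sign are replaced by $0$). The nodes know which node of $S$ has the smallest identifier and a set $R\subseteq\mathbb R$ of legal values. The primitive Aggregate-Sketch-Vector with parameters $\ell,T_p,T_s$ runs two instances $\sigma\in\{+,-\}$ of push-sum in parallel, for $T_s$ phases of $T_p$ rounds each. In instance $\sigma$ node $u$ starts with the vector $s^\sigma(u)$ and with weight $1$ if it has the smallest identifier in $S$, and $0$ otherwise. In each phase every node $u$ keeps one half of its pair (vector, weight) and gives the other half to a lazy random walk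 that starts at $u$ and makes $\ell$ steps in $G'$, each step moving to each neighbour with probability $1/(2d)$ and otherwise staying; all steps are independent. In round $r=0,1,\dots$ of the phase a node contacts only its neighbour number $r \bmod d$ (if there is one) and sends it at most one of the walks that wait to move there, one with the fewest steps made; a staying step is made locally in one round. At the end of the phase the half pair is delivered to the node that holds the walk, and every node adds up its pairs. After $T_s$ phases node $u$ rounds each entry of (vector)/(weight) to a nearest element of $R$, in both instances, and outputs the sum of the two results. We say that the primitive succeeds if at every $u\in S$ both final weights are positive and the output is exactly $\sum_{v\in S}s(v)$. (1) Let $d\ge1$ be an integer and $\varphi,c,\gamma>0$. There are $K$, $n_0$ and parameters $\ell(n)\le K\log n$, $T_p(n)\le K\log^2 n$, $T_s(n,x)\le K\log n\,\log(nx)$ with $T_s(n,x)T_p(n)\le K\log^3 n\,\log(nx)$ (for $n\ge n_0$, $x\ge c$) such that the following holds for all $n\ge n_0$, all networks with at most $n$ nodes, and all $S$, $G'$ as above. Suppose that any two distinct elements of $R$ are at distance at least $c$; that $0\in R$; that all entries of all $s(u)$ lie in $R\cap[L,U]$, where $L\le 0\le U$ and $U-L=x\ge c$; and that all entries of the aggregates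 $\sum_{u\in S}s^+(u)$ and $\sum_{u\in S}s^-(u)$ lie in $R$. (For example, $R=c\mathbb Z$ and all entries of the sketch vectors lie in $c\mathbb Z\cap[L,U]$.) Then the primitive, run for these $T_s(n,x)\,T_p(n)=O(\log^3 n\,\log(nx))$ rounds, succeeds with probability at least $1-n^{-\gamma}$. (2) Let $d\ge 1$, $a\ge 0$ be integers, let $c_0,C\in\mathbb R$ and $\varphi,\gamma>0$. There are $K$, $n_0$ and parameters $\ell(n)\le K\log n$, $T_p(n)\le K\log^2 n$, $T_s(n)\le K\log^2 n$, $B(n)\le K\log^2 n$ with $T_s(n)T_p(n)\le K\log^4 n$ (for $n\ge n_0$) such that the following holds for all $n\ge n_0$, all networks with at most $n$ nodes, and all $S$, $G'$ as above. Let the identifiers lie in $\{1,\dots,N\}$ with $N\le n^{c_0}$, let $G=(V,E)$ be any graph, and let $M$ be a $k\times\binom N2$ graph sketching matrix with integer entries of absolute value at most $CN^a$. For $v\in V$ let $i_G(v)\in\mathbb R^{\binom N2}$ be the incidence vector: its entry at the pair of the identifiers of $u$ and $v$ is $1$ if $uv\in E$ and $\mathrm{id}_u>\mathrm{id}_v$,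 and $-1$ if $uv\in E$ and $\mathrm{id}_u<\mathrm{id}_v$; all other entries are $0$. Let $s_G(v)=M\,i_G(v)$. Then the primitive, run with $s=s_G$ and $R=\mathbb Z$ for these $T_s(n)\,T_p(n)=O(\log^4 n)$ rounds, gives every node of $S$ the exact aggregate sketch vector $s_G(S)=\sum_{u\in S}s_G(u)$ with probability at least $1-n^{-\gamma}$ (it succeeds). Moreover, for every outcome of the random choices, each number in each pair that is sent is of the form $m/2^e$ with integers $|m|\le 2^{B(n)}$ and $0\le e\le B(n)$, that is, has $O(\log^2 n)$ bits. -/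

import Mathlib

namespace GossipSketch

/-! ### Expanders -/

section Expander

variable {W : Type*} [Fintype W]

open scoped Classical in
/-- The number of neighbours of `u`. -/
noncomputable def deg (G : SimpleGraph W) (u : W) : ℕ := (G.neighborFinset u).card

/-- The volume of a node set. -/
noncomputable def vol (G : SimpleGraph W) (A : Finset W) : ℕ := ∑ v ∈ A, deg G v

open scoped Classical in
/-- The number of edges with exactly one endpoint in `A`. -/
noncomputable def cutSize (G : SimpleGraph W) (A : Finset W) : ℕ := (G.interedges A Aᶜ).card

open scoped Classical in
/-- The conductance of a node set. -/
noncomputable def setConductance (G : SimpleGraph W) (A : Finset W) : ℝ :=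
  (cutSize G A : ℝ) / (min (vol G A) (vol G Aᶜ) : ℕ)

/-- `G` is a connected graph whose conductance is at least `φ`. (In a connected graph every
nonempty proper node set and its complement have positive volume. A single node is allowed.) -/
def IsExpander (φ : ℝ) (G : SimpleGraph W) : Prop :=
  G.Connected ∧
    ∀ A : Finset W, A.Nonempty → A ≠ Finset.univ → φ ≤ setConductance G A

end Expander

/-! ### One phase: parallel lazy random walks under gossip communication

In a phase, every node starts two walks of length `ℓ`, one for each of the two instances
(positive part: `true`, negative part: `false`) of the averaging process. -/

section Walks

variable {W : Type*} [Fintype W]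

/-- A walk is named by its instance and its starting node. -/
abbrev Token (W : Type*) := Bool × W

/-- The random choices of one phase: for each walk and each of its `ℓ` steps a number below
`2 * d`. A number `p` below the degree of the current node means "move to neighbour number `p`";
any other number means "stay". So each neighbour is chosen with probability `1 / (2 * d)`, and the
walk stays with probability at least `1 / 2` (`d` bounds all degrees). -/
abbrev PhaseCoins (W : Type*) (d ℓ : ℕ) := Token W → Fin ℓ → Fin (2 * d)

/-- The current node of every walk, and the number of steps it has made. -/
abbrev WalkState (W : Type*) := Token W → W × ℕ

open scoped Classical in
/-- Neighbour number `p` of `u`, in a fixed numbering `0, 1, …, deg u - 1` of its neighbours. -/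
noncomputable def port (G : SimpleGraph W) (u : W) (p : ℕ) : Option W :=
  if h : p < (G.neighborFinset u).card then
    some ((G.neighborFinset u).equivFin.symm ⟨p, h⟩).1
  else none

/-- The choice for the next step of the walk `τ`; `none` if all its steps are made. -/
def choice {d ℓ : ℕ} (coins : PhaseCoins W d ℓ) (σ : WalkState W) (τ : Token W) : Option ℕ :=
  if h : (σ τ).2 < ℓ then some (coins τ ⟨(σ τ).2, h⟩).val else none

open scoped Classical in
/-- The walks at node `u` whose next choice is `p`. -/
noncomputable def waiting {d ℓ : ℕ} (coins : PhaseCoins W d ℓ) (σ : WalkState W) (u : W) (p : ℕ) :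
    Finset (Token W) :=
  {τ | (σ τ).1 = u ∧ choice coins σ τ = some p}

open scoped Classical in
/-- The message that `u` sends in round `r` of a phase. The node `u` contacts its neighbours in
turn: in round `r` it contacts only neighbour number `r % d` (if there is one), and it sends at most
one walk there, among those that wait for this neighbour one with the fewest steps made. -/
noncomputable def sent {d ℓ : ℕ} (G : SimpleGraph W) (coins : PhaseCoins W d ℓ) (r : ℕ)
    (σ : WalkState W) (u : W) : Option (Token W) :=
  if h : (port G u (r % d)).isSome ∧ (waiting coins σ u (r % d)).Nonempty then
    some (Classical.choose
      (Finset.exists_min_image (waiting coins σ u (r % d)) (fun τ => (σ τ).2) h.2))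
  else none

open scoped Classical in
/-- Round `r` of a phase. A walk whose next step is to stay makes that step locally; a walk whose
next step is a move makes it if it is sent, and otherwise waits. -/
noncomputable def roundStep {d ℓ : ℕ} (G : SimpleGraph W) (coins : PhaseCoins W d ℓ) (r : ℕ)
    (σ : WalkState W) : WalkState W := fun τ =>
  match choice coins σ τ with
  | none => σ τ
  | some p =>
    match port G (σ τ).1 p with
    | none => ((σ τ).1, (σ τ).2 + 1)
    | some v => if sent G coins r σ (σ τ).1 = some τ then (v, (σ τ).2 + 1) else σ τ

/-- The walks after the first `r` rounds of a phase. -/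
noncomputable def walkState {d ℓ : ℕ} (G : SimpleGraph W) (coins : PhaseCoins W d ℓ) :
    ℕ → WalkState W
  | 0 => fun τ => (τ.2, 0)
  | r + 1 => roundStep G coins r (walkState G coins r)

/-- The node that holds the walk `τ` at the end of a phase of `Tp` rounds. -/
noncomputable def destination {d ℓ : ℕ} (G : SimpleGraph W) (coins : PhaseCoins W d ℓ) (Tp : ℕ)
    (τ : Token W) : W :=
  (walkState G coins Tp τ).1

end Walks

/-! ### The primitive -/

section PushSum

variable {W : Type*} [Fintype W]

open scoped Classical in
/-- What the nodes hold after `t` phases of push-sum, if in phase `t` (counted from `0`) node `u`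
sends one half of what it holds to itself and the other half to `dest t u`. -/
noncomputable def pushSum {M : Type*} [AddCommGroup M] [Module ℝ M] (dest : ℕ → W → W)
    (init : W → M) : ℕ → W → M
  | 0 => init
  | t + 1 => fun v => (1 / 2 : ℝ) • pushSum dest init t v +
      ∑ u ∈ Finset.univ.filter (fun u => dest t u = v), (1 / 2 : ℝ) • pushSum dest init t u

/-- The random choices of a run of `Ts` phases. -/
abbrev RunCoins (W : Type*) (d ℓ Ts : ℕ) := Fin Ts → PhaseCoins W d ℓ

/-- In instance `b`, the node to which `u` sends one half of its pair in phase `t`. -/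
noncomputable def target {d ℓ Ts : ℕ} (G : SimpleGraph W) (Tp : ℕ) (ω : RunCoins W d ℓ Ts)
    (b : Bool) (t : ℕ) (u : W) : W :=
  if h : t < Ts then destination G (ω ⟨t, h⟩) Tp (b, u) else u

open scoped Classical in
/-- The initial weights: `1` at the node of minimum identifier, `0` elsewhere. -/
noncomputable def initWeight (ID : W → ℕ) (u : W) : ℝ := if ∀ v, ID u ≤ ID v then 1 else 0

/-- The positive (`true`) or negative (`false`) part of a vector: the entries of the other sign
are replaced by `0`. -/
noncomputable def part {κ : Type*} (b : Bool) (y : κ → ℝ) : κ → ℝ :=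
  fun j => if b then max (y j) 0 else min (y j) 0

/-- The weight of node `u` in instance `b` after `t` phases. -/
noncomputable def weight {d ℓ Ts : ℕ} (G : SimpleGraph W) (ID : W → ℕ) (Tp : ℕ)
    (ω : RunCoins W d ℓ Ts) (b : Bool) (t : ℕ) : W → ℝ :=
  pushSum (target G Tp ω b) (initWeight ID) t

/-- The vector of node `u` in instance `b` after `t` phases, for initial sketch vectors `s`. -/
noncomputable def vector {κ : Type*} {d ℓ Ts : ℕ} (G : SimpleGraph W) (Tp : ℕ) (s : W → κ → ℝ)
    (ω : RunCoins W d ℓ Ts) (b : Bool) (t : ℕ) : W → κ → ℝ :=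
  pushSum (target G Tp ω b) (fun u => part b (s u)) t

open scoped Classical in
/-- A nearest point of `R` to `y` (`0` if there is none). -/
noncomputable def roundTo (R : Set ℝ) (y : ℝ) : ℝ :=
  if h : ∃ r ∈ R, ∀ r' ∈ R, |y - r| ≤ |y - r'| then Classical.choose h else 0

/-- The output of node `u` after `Ts` phases of `Tp` rounds each: in both instances, the ratio of
vector and weight is rounded entrywise to the set `R` of legal values; the results are added. -/
noncomputable def output {κ : Type*} {d ℓ Ts : ℕ} (G : SimpleGraph W) (ID : W → ℕ) (R : Set ℝ)
    (Tp : ℕ) (s : W → κ → ℝ) (ω : RunCoins W d ℓ Ts) (u : W) : κ → ℝ := fun j =>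
  roundTo R (vector G Tp s ω true Ts u j / weight G ID Tp ω true Ts u) +
    roundTo R (vector G Tp s ω false Ts u j / weight G ID Tp ω false Ts u)

/-- Every node has an estimate (its final weights are not zero), and its output is the sum of all
the initial sketch vectors. -/
def AllCorrect {κ : Type*} {d ℓ Ts : ℕ} (G : SimpleGraph W) (ID : W → ℕ) (R : Set ℝ)
    (Tp : ℕ) (s : W → κ → ℝ) (ω : RunCoins W d ℓ Ts) : Prop :=
  ∀ u, (∀ b, 0 < weight G ID Tp ω b Ts u) ∧ output G ID R Tp s ω u = ∑ v, s v

/-- The probability that the primitive, run on `G` for `Ts` phases of `Tp` rounds each with walks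
of length `ℓ`, gives every node the aggregate sketch vector. All random choices are uniform and
independent. -/
noncomputable def successProb {κ : Type*} (G : SimpleGraph W) (ID : W → ℕ) (R : Set ℝ)
    (d ℓ Tp Ts : ℕ) (s : W → κ → ℝ) : ℝ :=
  (ProbabilityTheory.uniformOn (Set.univ : Set (RunCoins W d ℓ Ts))).real
    {ω | AllCorrect G ID R Tp s ω}

/-- `z` is a binary fraction whose numerator has at most `B` bits and which has at most `B` binary
digits after the point. -/
def FitsBits (B : ℕ) (z : ℝ) : Prop :=
  ∃ (m : ℤ) (e : ℕ), e ≤ B ∧ |m| ≤ 2 ^ B ∧ z = (m : ℝ) / 2 ^ e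

/-- Every number in a pair (one half of a vector, one half of a weight) that some node sends in
some phase, for any outcome of the random choices, fits into `B` bits. -/
def MessagesFit {κ : Type*} (G : SimpleGraph W) (ID : W → ℕ) (d ℓ Tp Ts : ℕ) (s : W → κ → ℝ)
    (B : ℕ) : Prop :=
  ∀ (ω : RunCoins W d ℓ Ts) (b : Bool) (t : ℕ) (u : W), t < Ts →
    FitsBits B (1 / 2 * weight G ID Tp ω b t u) ∧
      ∀ j, FitsBits B (1 / 2 * vector G Tp s ω b t u j)

end PushSum

/-! ### Graph sketches -/

section Sketch

variable {V : Type*}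

/-- The unordered pairs of distinct identifiers, as ordered pairs. -/
abbrev IDPair (N : ℕ) := {p : Fin N × Fin N // p.1 < p.2}

open scoped Classical in
/-- The incidence vector of `v`: at the pair of the identifiers of `u` and `v` it is `0` if `u`
and `v` are not adjacent, `1` if they are and `ID u > ID v`, and `-1` if they are and
`ID u < ID v`; all other entries are `0`. -/
noncomputable def incidence {N : ℕ} (G : SimpleGraph V) (ID : V → Fin N) (v : V) (p : IDPair N) :
    ℤ :=
  if ID v = p.1.1 ∧ ∃ u, ID u = p.1.2 ∧ G.Adj u v then 1
  else if ID v = p.1.2 ∧ ∃ u, ID u = p.1.1 ∧ G.Adj u v then -1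
  else 0

/-- The sketch vector of `v` under the sketching matrix `M`. -/
noncomputable def sketch {N k : ℕ} (M : Matrix (Fin k) (IDPair N) ℤ) (G : SimpleGraph V)
    (ID : V → Fin N) (v : V) : Fin k → ℝ :=
  fun j => ((M.mulVec (incidence G ID v)) j : ℝ)

end Sketch

end GossipSketch

/-!
In one phase every node sends half of its pair along a lazy random walk. The proof has three layers.

*Scheduling.* The nodes visited by a walk depend only on its own choices (`walkPos`), not on the
rounds in which the steps are made. The uniform distribution is stationary, so at each step a node
holds two walks in expectation, and by a Chernoff bound (`frac_congested_le`) rarely more than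
`O(log n)`. Since walks with fewer steps have priority, all walks make step `i + 1` within
`O(log n)` rounds after all have made step `i` (`destination_eq_walkPos`); so, without congestion,
the half pair is delivered to the true end of an `ℓ`-step lazy walk.

*One phase.* Cheeger's inequality (`cheeger`) gives the lazy walk a constant spectral gap, so after
`ℓ = O(log n)` steps its distribution is within a factor `2` from below of the uniform one, and its
operator contracts vectors of mean zero. Two potentials then shrink by a constant factor in
expectation in every phase: the squared norm of a push-sum vector of mean zero
(`expect_sum_pushStep_le`), and the quantity `|W| / |I| - 1`, where `I` is the set of nodes that
mass starting at a given node has reached (`expect_spreadPot_le`). The number of phases is not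
bounded in terms of `n`, so congestion cannot be excluded in all of them. But a congested phase
cannot increase the second potential, and increases the first at most by the factor `|W|`, so that
rare congestion changes the expectations only slightly.

*A run.* The difference between the vector and the weight times the aggregate is a push-sum of
mean-zero vectors (`pushSum_sub_mul`), hence exponentially small after many phases. The weights stay
polynomially large: before the last `O(log n)` phases some node has the average weight, and in these
phases it spreads to all nodes, being divided by at most `2` in each phase
(`le_pushSum_of_mem_spreadSet`). So the ratio is closer than `c / 2` to the aggregate, and rounding
is exact (`allCorrect_of_lt`). The statement about graph sketches is a special case, in which the
numbers are binary fractions with one more binary digit after the point in each phase.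
-/

namespace GossipSketch

open scoped BigOperators

/-! ### Averages over independent choices -/

section Average

variable {ι C : Type*} [Fintype ι] [DecidableEq ι] [Fintype C] [Nonempty C]

/-- Choosing one coordinate anew does not change the average. -/
lemma expect_update (F : (ι → C) → ℝ) (i : ι) :
    𝔼 ω, 𝔼 c, F (Function.update ω i c) = 𝔼 ω, F ω := by
  have h : 𝔼 x : (ι → C) × C, F (Function.update x.1 i x.2) = 𝔼 x : (ι → C) × C, F x.1 := by
    let e : (ι → C) × C → (ι → C) × C := fun x => (Function.update x.1 i x.2, x.1 i)
    have he : Function.Involutive e := by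
      rintro ⟨ω, c⟩
      simp [e]
    exact Fintype.expect_equiv he.toPerm _ _ fun x => rfl
  rw [← Finset.univ_product_univ, Finset.expect_product, Finset.expect_product] at h
  simpa using h

lemma expect_eval (g : C → ℝ) (i : ι) : 𝔼 ω : ι → C, g (ω i) = 𝔼 c, g c := by
  rw [← expect_update _ i]
  simp

lemma expect_eval_mul_eval (g h : C → ℝ) {i j : ι} (hij : i ≠ j) :
    𝔼 ω : ι → C, g (ω i) * h (ω j) = (𝔼 c, g c) * 𝔼 c, h c := by
  rw [← expect_update _ i]
  simp only [Function.update_self, Function.update_of_ne hij.symm, ← Finset.expect_mul,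
    ← Finset.mul_expect]
  rw [expect_eval]

/-- The mean of a product of independent variables is the product of their means. -/
lemma expect_prod {κ : Type*} {e : κ → ι} (he : Function.Injective e) (I : Finset κ)
    (g : κ → C → ℝ) :
    𝔼 ω : ι → C, ∏ k ∈ I, g k (ω (e k)) = ∏ k ∈ I, 𝔼 c, g k c := by
  classical
  induction I using Finset.induction_on with
  | empty => simp
  | insert k I hk ih =>
    rw [Finset.prod_insert hk, ← ih, ← expect_update _ (e k), Finset.mul_expect]
    refine Finset.expect_congr rfl fun ω _ => ?_
    rw [Finset.expect_mul]
    refine Finset.expect_congr rfl fun c _ => ?_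
    rw [Finset.prod_insert hk, Function.update_self]
    congr 1
    refine Finset.prod_congr rfl fun j hj => ?_
    rw [Function.update_of_ne]
    exact he.ne fun h => hk (h ▸ hj)

/-- The second moment of a sum of independent variables is at most the sum of their second moments
plus the square of the mean. -/
lemma expect_sum_sq_le {κ : Type*} [Fintype κ] [DecidableEq κ] {e : κ → ι}
    (he : Function.Injective e) (Z : κ → C → ℝ) :
    𝔼 ω : ι → C, (∑ k, Z k (ω (e k))) ^ 2 ≤ ∑ k, 𝔼 c, Z k c ^ 2 + (∑ k, 𝔼 c, Z k c) ^ 2 := by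
  simp only [sq (∑ k, _), Finset.sum_mul_sum, Finset.expect_sum_comm]
  rw [← Finset.sum_add_distrib]
  refine Finset.sum_le_sum fun k _ => ?_
  rw [← Finset.add_sum_erase _ _ (Finset.mem_univ k),
    ← Finset.add_sum_erase _ (fun j => (𝔼 c, Z k c) * 𝔼 c, Z j c) (Finset.mem_univ k)]
  have h1 : 𝔼 ω : ι → C, Z k (ω (e k)) * Z k (ω (e k)) = 𝔼 c, Z k c ^ 2 := by
    rw [expect_eval (fun c => Z k c * Z k c)]
    simp only [sq]
  have h2 : ∀ j ∈ Finset.univ.erase k, 𝔼 ω : ι → C, Z k (ω (e k)) * Z j (ω (e j)) =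
      (𝔼 c, Z k c) * 𝔼 c, Z j c := fun j hj =>
    expect_eval_mul_eval _ _ (he.ne (Finset.ne_of_mem_erase hj).symm)
  rw [h1, Finset.sum_congr rfl h2]
  nlinarith [mul_self_nonneg (𝔼 c, Z k c)]

end Average

section Frac

variable {Ω : Type*} [Fintype Ω]

open scoped Classical in
/-- The fraction of the outcomes that have the property `p`. -/
noncomputable def frac (p : Ω → Prop) : ℝ := 𝔼 ω, if p ω then 1 else 0

lemma frac_mono {p q : Ω → Prop} (h : ∀ ω, p ω → q ω) : frac p ≤ frac q := by
  refine Finset.expect_le_expect fun ω _ => ?_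
  split_ifs with h1 h2 <;> first | exact absurd (h ω ‹_›) ‹_› | norm_num

lemma frac_or_le (p q : Ω → Prop) : frac (fun ω => p ω ∨ q ω) ≤ frac p + frac q := by
  rw [frac, frac, frac, ← Finset.expect_add_distrib]
  refine Finset.expect_le_expect fun ω _ => ?_
  by_cases h1 : p ω <;> by_cases h2 : q ω <;> simp [h1, h2]

lemma frac_exists_le {κ : Type*} [Fintype κ] (p : κ → Ω → Prop) :
    frac (fun ω => ∃ k, p k ω) ≤ ∑ k, frac (p k) := by
  classical
  simp only [frac]
  rw [← Finset.expect_sum_comm]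
  refine Finset.expect_le_expect fun ω _ => ?_
  split_ifs with h
  · obtain ⟨k, hk⟩ := h
    refine le_trans (by simp [hk]) (Finset.single_le_sum
      (f := fun k => if p k ω then (1 : ℝ) else 0) (fun i _ => ?_) (Finset.mem_univ k))
    split_ifs <;> norm_num
  · exact Finset.sum_nonneg fun i _ => by split_ifs <;> norm_num

/-- Markov's inequality. -/
lemma frac_le_div {p : Ω → Prop} {F : Ω → ℝ} {a : ℝ} (ha : 0 < a) (hF : ∀ ω, 0 ≤ F ω)
    (h : ∀ ω, p ω → a ≤ F ω) : frac p ≤ (𝔼 ω, F ω) / a := by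
  rw [frac, Finset.expect_div]
  refine Finset.expect_le_expect fun ω _ => ?_
  split_ifs with hp
  · rw [le_div_iff₀ ha]
    linarith [h ω hp]
  · exact div_nonneg (hF ω) ha.le

lemma frac_not [Nonempty Ω] (p : Ω → Prop) : frac (fun ω => ¬ p ω) = 1 - frac p := by
  have h : frac (fun ω => ¬ p ω) + frac p = 1 := by
    rw [frac, frac, ← Finset.expect_add_distrib, ← Fintype.expect_const (ι := Ω) (1 : ℝ)]
    refine Finset.expect_congr rfl fun ω _ => ?_
    by_cases hp : p ω <;> simp [hp]
  linarith

/-- If `F` agrees with `F'` except on the outcomes with property `p`, and is nowhere greater than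
`b`, its average exceeds that of `F'` by at most `b` times the fraction of these outcomes. -/
lemma expect_le_add_frac_mul {p : Ω → Prop} {F F' : Ω → ℝ} {b : ℝ} (hF' : ∀ ω, 0 ≤ F' ω)
    (h : ∀ ω, ¬ p ω → F ω = F' ω) (hb : ∀ ω, F ω ≤ b) :
    𝔼 ω, F ω ≤ 𝔼 ω, F' ω + frac p * b := by
  classical
  rw [frac, Finset.expect_mul, ← Finset.expect_add_distrib]
  refine Finset.expect_le_expect fun ω _ => ?_
  by_cases hp : p ω
  · simpa [hp] using le_add_of_nonneg_of_le (hF' ω) (hb ω)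
  · simp [hp, h ω hp]

/-- The probability of `p` under the uniform distribution. -/
lemma uniformOn_real_eq_frac [MeasurableSpace Ω] [MeasurableSingletonClass Ω] (p : Ω → Prop) :
    (ProbabilityTheory.uniformOn (Set.univ : Set Ω)).real {ω | p ω} = frac p := by
  classical
  rw [MeasureTheory.measureReal_def, ProbabilityTheory.uniformOn_univ,
    MeasureTheory.Measure.count_apply_finite _ (Set.toFinite _), frac,
    Fintype.expect_eq_sum_div_card]
  simp [ENNReal.toReal_div]

end Frac

section Iterate

variable {C : Type*} [Fintype C] [Nonempty C]

/-- A potential that shrinks by a factor `ρ` in expectation in every phase from phase `T` on,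
whatever happened before, has shrunk by `ρ ^ j` in expectation after `j` such phases. -/
lemma expect_le_pow_mul {N : ℕ} (V : ℕ → (Fin N → C) → ℝ) {ρ : ℝ} (hρ : 0 ≤ ρ) (T : ℕ)
    (h : ∀ t (ht : t < N) ω, T ≤ t →
      𝔼 c, V (t + 1) (Function.update ω ⟨t, ht⟩ c) ≤ ρ * V t ω)
    (j : ℕ) (hj : T + j ≤ N) : 𝔼 ω, V (T + j) ω ≤ ρ ^ j * 𝔼 ω, V T ω := by
  induction j with
  | zero => simp
  | succ j ih =>
    have hlt : T + j < N := by omega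
    rw [← add_assoc, ← expect_update _ ⟨T + j, hlt⟩]
    calc 𝔼 ω, 𝔼 c, V (T + j + 1) (Function.update ω ⟨T + j, hlt⟩ c)
        ≤ 𝔼 ω, ρ * V (T + j) ω := Finset.expect_le_expect fun ω _ => h _ hlt ω (by omega)
      _ = ρ * 𝔼 ω, V (T + j) ω := (Finset.mul_expect _ _ _).symm
      _ ≤ ρ * (ρ ^ j * 𝔼 ω, V T ω) := mul_le_mul_of_nonneg_left (ih (by omega)) hρ
      _ = ρ ^ (j + 1) * 𝔼 ω, V T ω := by ring

end Iterate

/-! ### The spectral gap of an expander -/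

section Gap

variable {W : Type*} [Fintype W]

open scoped Classical in
lemma sum_nbr_comm (G : SimpleGraph W) (F : W → W → ℝ) :
    ∑ u, ∑ v ∈ G.neighborFinset u, F u v = ∑ u, ∑ v ∈ G.neighborFinset u, F v u :=
  Finset.sum_comm' fun x y => by simp [G.adj_comm]

open scoped Classical in
/-- The conductance bound with cardinalities in place of volumes, in the form
`φ |A| |Aᶜ| ≤ |W| cutSize A`. It is linear in the indicators of the cut pairs, so that it can be
integrated over the level sets of a function. -/
lemma sum_cut_le {φ : ℝ} (hφ : 0 < φ) {G : SimpleGraph W} (hG : IsExpander φ G) (A : Finset W) :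
    φ * ∑ u, ∑ v, (if u ∈ A ∧ v ∉ A then (1 : ℝ) else 0) ≤
      Fintype.card W * ∑ u, ∑ v ∈ G.neighborFinset u, (if u ∈ A ∧ v ∉ A then (1 : ℝ) else 0) := by
  have h1 : ∑ u, ∑ v, (if u ∈ A ∧ v ∉ A then (1 : ℝ) else 0) = A.card * Aᶜ.card := by
    have : ∀ v, (if v ∈ A then (0 : ℝ) else 1) = if v ∈ Aᶜ then 1 else 0 := fun v => by
      by_cases hv : v ∈ A <;> simp [hv]
    simp only [ite_and, ite_not, this]
    simp [-Finset.mem_compl]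
  have h2 : ∑ u, ∑ v ∈ G.neighborFinset u, (if u ∈ A ∧ v ∉ A then (1 : ℝ) else 0) =
      cutSize G A := by
    have : ∀ u, ∑ v ∈ G.neighborFinset u, (if u ∈ A ∧ v ∉ A then (1 : ℝ) else 0) =
        ∑ v, if u ∈ A ∧ v ∉ A ∧ G.Adj u v then (1 : ℝ) else 0 := fun u => by
      rw [← Finset.sum_filter, ← Finset.sum_filter]
      refine Finset.sum_congr ?_ fun _ _ => rfl
      ext v; simp; tauto
    simp only [this]
    rw [← Fintype.sum_prod_type' (f := fun u v => if u ∈ A ∧ v ∉ A ∧ G.Adj u v then (1 : ℝ) else 0),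
      Finset.sum_boole, cutSize]
    congr 2
    ext ⟨u, v⟩
    simp [SimpleGraph.mem_interedges_iff]
  rw [h1, h2]
  have key : ∀ B : Finset W, B.Nonempty → B ≠ Finset.univ →
      0 < min (vol G B) (vol G Bᶜ) ∧ φ * (min (vol G B) (vol G Bᶜ) : ℕ) ≤ cutSize G B := by
    intro B hB hB'
    have h := hG.2 B hB hB'
    rw [setConductance] at h
    have hpos : 0 < min (vol G B) (vol G Bᶜ) := by
      rcases Nat.eq_zero_or_pos (min (vol G B) (vol G Bᶜ)) with h0 | h0
      · rw [h0] at h; simp at h; linarith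
      · exact h0
    exact ⟨hpos, (le_div_iff₀ (by exact_mod_cast hpos)).1 h⟩
  rcases A.eq_empty_or_nonempty with rfl | hA
  · simp; positivity
  by_cases hA' : A = Finset.univ
  · subst hA'; simp; positivity
  -- a single node has positive volume, since its conductance is positive
  have hdeg : ∀ u, 1 ≤ deg G u := fun u => by
    have hne : ({u} : Finset W) ≠ Finset.univ := fun h => by
      obtain ⟨a, ha⟩ := hA
      have hs : ∀ x, x = u := fun x => by
        have := Finset.mem_univ x
        rwa [← h, Finset.mem_singleton] at this
      refine hA' (Finset.eq_univ_iff_forall.2 fun x => ?_)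
      rwa [hs x, ← hs a]
    have := (key {u} (Finset.singleton_nonempty u) hne).1
    have h3 := lt_of_lt_of_le this (min_le_left _ _)
    simpa [vol, Nat.one_le_iff_ne_zero, Nat.pos_iff_ne_zero] using h3
  have hvol : ∀ B : Finset W, B.card ≤ vol G B := fun B => by
    rw [vol, Finset.card_eq_sum_ones]
    exact Finset.sum_le_sum fun u _ => hdeg u
  have h3 := (key A hA hA').2
  have h4 : A.card * Aᶜ.card ≤ Fintype.card W * min (vol G A) (vol G Aᶜ) := by
    rcases min_choice (vol G A) (vol G Aᶜ) with h | h <;> rw [h]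
    · rw [mul_comm]; exact Nat.mul_le_mul (Finset.card_le_univ _) (hvol _)
    · exact Nat.mul_le_mul (Finset.card_le_univ _) (hvol _)
  calc φ * ((A.card : ℝ) * Aᶜ.card)
      ≤ φ * (Fintype.card W * (min (vol G A) (vol G Aᶜ) : ℕ)) := by
        refine mul_le_mul_of_nonneg_left ?_ hφ.le
        exact_mod_cast h4
    _ = Fintype.card W * (φ * (min (vol G A) (vol G Aᶜ) : ℕ)) := by ring
    _ ≤ _ := by gcongr

open scoped Classical in
/-- The cut inequality for functions: both sides are averages over the level sets `{u | t ≤ h u}`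
of the two sides of the inequality for sets. -/
lemma sum_max_le {φ : ℝ} (hφ : 0 < φ) {G : SimpleGraph W} (hG : IsExpander φ G) (h : W → ℝ) :
    φ * ∑ u, ∑ v, max (h u - h v) 0 ≤
      Fintype.card W * ∑ u, ∑ v ∈ G.neighborFinset u, max (h u - h v) 0 := by
  let F : W → W → ℝ → ℝ := fun u v => Set.indicator (Set.Ioc (h v) (h u)) 1
  have hint : ∀ u v, MeasureTheory.Integrable (F u v) := fun u v =>
    (MeasureTheory.integrable_indicator_iff measurableSet_Ioc).2
      (MeasureTheory.integrableOn_const (by simp))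
  have hval : ∀ u v, max (h u - h v) 0 = ∫ t, F u v t := fun u v => by
    rw [MeasureTheory.integral_indicator_one measurableSet_Ioc, Real.volume_real_Ioc]
  simp only [hval]
  simp only [← MeasureTheory.integral_finsetSum _ fun i _ => hint _ i]
  rw [← MeasureTheory.integral_finsetSum _ fun i _ =>
      MeasureTheory.integrable_finsetSum _ fun j _ => hint i j,
    ← MeasureTheory.integral_finsetSum _ fun i _ =>
      MeasureTheory.integrable_finsetSum _ fun j _ => hint i j,
    ← MeasureTheory.integral_const_mul, ← MeasureTheory.integral_const_mul]
  refine MeasureTheory.integral_mono ?_ ?_ fun t => ?_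
  · exact (MeasureTheory.integrable_finsetSum _ fun i _ =>
      MeasureTheory.integrable_finsetSum _ fun j _ => hint i j).const_mul _
  · exact (MeasureTheory.integrable_finsetSum _ fun i _ =>
      MeasureTheory.integrable_finsetSum _ fun j _ => hint i j).const_mul _
  · have := sum_cut_le hφ hG (Finset.univ.filter fun u => t ≤ h u)
    simpa [F, Set.indicator_apply, and_comm] using this

open scoped Classical in
lemma sum_abs_le {φ : ℝ} (hφ : 0 < φ) {G : SimpleGraph W} (hG : IsExpander φ G) (h : W → ℝ) :
    φ * ∑ u, ∑ v, |h u - h v| ≤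
      Fintype.card W * ∑ u, ∑ v ∈ G.neighborFinset u, |h u - h v| := by
  have h1 := sum_max_le hφ hG h
  have h2 := sum_max_le hφ hG (fun u => - h u)
  have h3 : ∀ u v, |h u - h v| = max (h u - h v) 0 + max (- h u - - h v) 0 := fun u v => by
    rcases le_total (h u) (h v) with h | h
    · rw [abs_of_nonpos, max_eq_right, max_eq_left] <;> linarith
    · rw [abs_of_nonneg, max_eq_left, max_eq_right] <;> linarith
  simp only [h3, Finset.sum_add_distrib, mul_add]
  linarith

/-- Together with `abs_sub_le_mul`, this relates the differences of a function to those of its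
signed square `f |f|`. -/
lemma sq_sub_le_abs (a b : ℝ) : (a - b) ^ 2 ≤ 2 * abs (a * |a| - b * |b|) := by
  rcases le_total 0 a with ha | ha <;> rcases le_total 0 b with hb | hb <;>
    simp only [abs_of_nonneg, abs_of_nonpos, ha, hb]
  · rcases le_total a b with h | h
    · nlinarith [neg_abs_le (a * a - b * b), mul_nonneg ha (sub_nonneg.2 h),
        mul_nonneg hb (sub_nonneg.2 h)]
    · nlinarith [le_abs_self (a * a - b * b), mul_nonneg ha (sub_nonneg.2 h),
        mul_nonneg hb (sub_nonneg.2 h)]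
  · nlinarith [le_abs_self (a * a - b * -b), sq_nonneg (a + b)]
  · nlinarith [neg_abs_le (a * -a - b * b), sq_nonneg (a + b)]
  · rcases le_total a b with h | h
    · nlinarith [neg_abs_le (a * -a - b * -b), mul_nonneg (neg_nonneg.2 ha) (sub_nonneg.2 h),
        mul_nonneg (neg_nonneg.2 hb) (sub_nonneg.2 h)]
    · nlinarith [le_abs_self (a * -a - b * -b), mul_nonneg (neg_nonneg.2 ha) (sub_nonneg.2 h),
        mul_nonneg (neg_nonneg.2 hb) (sub_nonneg.2 h)]

lemma abs_sub_le_mul (a b : ℝ) : abs (a * |a| - b * |b|) ≤ |a - b| * (|a| + |b|) := by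
  have : a * |a| - b * |b| = ((a - b) * (|a| + |b|) + (a + b) * (|a| - |b|)) / 2 := by ring
  rw [this, abs_div, abs_two, div_le_iff₀ two_pos]
  refine (abs_add_le _ _).trans ?_
  rw [abs_mul, abs_mul, abs_of_nonneg (a := |a| + |b|) (by positivity)]
  have := mul_le_mul (abs_add_le a b) (abs_abs_sub_abs_le a b) (abs_nonneg _) (by positivity)
  linarith

open scoped Classical in
/-- Cheeger's inequality, as a Poincaré inequality: in an expander, the energy of a function of
mean zero is at least a constant fraction of its squared norm. The cut inequality `sum_abs_le` is
applied to the signed square `f |f|` and combined with the Cauchy-Schwarz inequality; as its left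
side runs over all pairs of nodes, no median is needed. -/
lemma cheeger {φ : ℝ} (hφ : 0 < φ) {G : SimpleGraph W} (hG : IsExpander φ G) {d : ℕ} (hd : 1 ≤ d)
    (hdeg : ∀ u, deg G u ≤ d) {f : W → ℝ} (hf : ∑ u, f u = 0) :
    φ ^ 2 / (4 * d) * ∑ u, f u ^ 2 ≤ ∑ u, ∑ v ∈ G.neighborFinset u, (f u - f v) ^ 2 := by
  have hne : Nonempty W := hG.1.nonempty
  set N := ∑ u, f u ^ 2 with hN
  set D := ∑ u, ∑ v ∈ G.neighborFinset u, (f u - f v) ^ 2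
  have hd0 : (0 : ℝ) < d := by exact_mod_cast hd
  have hm : (0 : ℝ) < Fintype.card W := by exact_mod_cast Fintype.card_pos
  have h1 := sum_abs_le hφ hG (fun u => f u * |f u|)
  have h2 : (Fintype.card W : ℝ) * N ≤ ∑ u, ∑ v, abs (f u * |f u| - f v * |f v|) := by
    have h3 : ∑ u, ∑ v, (f u - f v) ^ 2 = 2 * (Fintype.card W * N) := by
      have : ∀ u v, (f u - f v) ^ 2 = f u ^ 2 + f v ^ 2 - 2 * f u * f v := fun u v => by ring
      simp only [this, Finset.sum_sub_distrib, Finset.sum_add_distrib, ← Finset.mul_sum, hf]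
      simp [← Finset.mul_sum, ← hN]; ring
    have h4 : ∑ u, ∑ v, (f u - f v) ^ 2 ≤ ∑ u, ∑ v, 2 * abs (f u * |f u| - f v * |f v|) :=
      Finset.sum_le_sum fun u _ => Finset.sum_le_sum fun v _ => sq_sub_le_abs _ _
    simp only [← Finset.mul_sum] at h4
    linarith
  have h5 : φ * N ≤ ∑ u, ∑ v ∈ G.neighborFinset u, abs (f u * |f u| - f v * |f v|) := by
    have h6 := mul_le_mul_of_nonneg_left h2 hφ.le
    refine le_of_mul_le_mul_left ?_ hm
    linarith
  have hS : ∑ u, ∑ v ∈ G.neighborFinset u, f u ^ 2 ≤ d * N := by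
    rw [hN, Finset.mul_sum]
    refine Finset.sum_le_sum fun u _ => ?_
    rw [Finset.sum_const, nsmul_eq_mul]
    exact mul_le_mul_of_nonneg_right (by exact_mod_cast hdeg u) (sq_nonneg _)
  have hS' : ∑ u, ∑ v ∈ G.neighborFinset u, f v ^ 2 ≤ d * N := by
    rwa [← sum_nbr_comm G fun u v => f u ^ 2]
  -- the weighted arithmetic-geometric mean inequality, with the weight `φ / (4 * d)` chosen such
  -- that the second term is at most half of the left side of `h5`
  have h7 : ∑ u, ∑ v ∈ G.neighborFinset u, abs (f u * |f u| - f v * |f v|) ≤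
      2 * d / φ * D + φ / (4 * d) * (∑ u, ∑ v ∈ G.neighborFinset u, f u ^ 2 +
        ∑ u, ∑ v ∈ G.neighborFinset u, f v ^ 2) := by
    simp only [D, Finset.mul_sum, ← Finset.sum_add_distrib]
    refine Finset.sum_le_sum fun u _ => Finset.sum_le_sum fun v _ => ?_
    refine (abs_sub_le_mul _ _).trans ?_
    have e1 : 2 * d / φ * (f u - f v) ^ 2 + φ / (4 * d) * (f u ^ 2 + f v ^ 2) -
        |f u - f v| * (|f u| + |f v|) =
        2 * d / φ * (|f u - f v| - φ / (4 * d) * (|f u| + |f v|)) ^ 2 +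
          φ / (8 * d) * (|f u| - |f v|) ^ 2 := by
      rw [← sq_abs (f u - f v), ← sq_abs (f u), ← sq_abs (f v)]
      field_simp
      ring
    have : 0 ≤ 2 * d / φ * (|f u - f v| - φ / (4 * d) * (|f u| + |f v|)) ^ 2 +
          φ / (8 * d) * (|f u| - |f v|) ^ 2 := by positivity
    linarith
  have h8 : φ / (4 * d) * (∑ u, ∑ v ∈ G.neighborFinset u, f u ^ 2 +
        ∑ u, ∑ v ∈ G.neighborFinset u, f v ^ 2) ≤ φ / 2 * N := by
    calc _ ≤ φ / (4 * d) * (d * N + d * N) := by gcongr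
      _ = φ / 2 * N := by field_simp; ring
  have h9 : φ / 2 * N ≤ 2 * d / φ * D := by linarith
  calc φ ^ 2 / (4 * d) * N = φ / (2 * d) * (φ / 2 * N) := by field_simp; ring
    _ ≤ φ / (2 * d) * (2 * d / φ * D) := by gcongr
    _ = D := by field_simp

end Gap

/-! ### The lazy random walk -/

section LazyWalk

variable {W : Type*} [Fintype W]

/-- The transition operator of the lazy walk: `lazyStep G d f u` is the mean of `f` at the node
reached from `u` in one step. Choices that name no neighbour mean staying. -/
noncomputable def lazyStep (G : SimpleGraph W) (d : ℕ) : Module.End ℝ (W → ℝ) where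
  toFun f u := 𝔼 p : Fin (2 * d), f ((port G u p).getD u)
  map_add' f g := by
    ext u
    simp [Finset.expect_add_distrib]
  map_smul' a f := by
    ext u
    simp [Finset.mul_expect]

lemma lazyStep_apply (G : SimpleGraph W) (d : ℕ) (f : W → ℝ) (u : W) :
    lazyStep G d f u = 𝔼 p : Fin (2 * d), f ((port G u p).getD u) := rfl

variable {G : SimpleGraph W} {d : ℕ}

open scoped Classical in
lemma lazyStep_eq (hd : 1 ≤ d) (hdeg : ∀ u, deg G u ≤ d) (f : W → ℝ) (u : W) :
    lazyStep G d f u = f u - (∑ v ∈ G.neighborFinset u, (f u - f v)) / (2 * d) := by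
  have hd0 : (0 : ℝ) < d := by exact_mod_cast hd
  have key : ∑ p : Fin (2 * d), (f u - f ((port G u p).getD u)) =
      ∑ v ∈ G.neighborFinset u, (f u - f v) := by
    rw [Fin.sum_univ_eq_sum_range (fun p => f u - f ((port G u p).getD u)) (2 * d)]
    have hle : (G.neighborFinset u).card ≤ 2 * d := (hdeg u).trans (by omega)
    rw [← Finset.sum_subset (Finset.range_mono hle)]
    · rw [← Fin.sum_univ_eq_sum_range (fun p => f u - f ((port G u p).getD u)),
        ← Finset.sum_coe_sort (G.neighborFinset u)]
      refine Fintype.sum_equiv (G.neighborFinset u).equivFin.symm _ _ fun p => ?_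
      have hp : (p : ℕ) < (G.neighborFinset u).card := p.2
      rw [port, dif_pos hp]
      rfl
    · intro p _ hp
      rw [Finset.mem_range] at hp
      rw [port, dif_neg hp]
      simp
  rw [Finset.sum_sub_distrib] at key
  rw [lazyStep_apply, Fintype.expect_eq_sum_div_card, ← key]
  simp only [Finset.sum_const, Finset.card_univ, Fintype.card_fin, nsmul_eq_mul]
  push_cast
  field_simp
  ring

lemma lazyStep_one (hd : 1 ≤ d) : lazyStep G d 1 = 1 := by
  have : NeZero (2 * d) := ⟨by omega⟩
  ext u
  simp [lazyStep_apply]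

lemma lazyStep_nonneg {f : W → ℝ} (hf : ∀ u, 0 ≤ f u) (u : W) : 0 ≤ lazyStep G d f u :=
  Finset.expect_nonneg fun _ _ => hf _

open scoped Classical in
/-- The transition operator is symmetric. -/
lemma sum_lazyStep_mul (hd : 1 ≤ d) (hdeg : ∀ u, deg G u ≤ d) (f g : W → ℝ) :
    ∑ u, lazyStep G d f u * g u = ∑ u, f u * lazyStep G d g u := by
  have h : ∀ f g : W → ℝ, ∑ u, lazyStep G d f u * g u = ∑ u, f u * g u -
      (∑ u, ∑ v ∈ G.neighborFinset u, f u * g u -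
        ∑ u, ∑ v ∈ G.neighborFinset u, f v * g u) / (2 * d) := fun f g => by
    simp only [lazyStep_eq hd hdeg, sub_mul, Finset.sum_sub_distrib, Finset.sum_mul,
      div_mul_eq_mul_div, ← Finset.sum_div]
  have h2 := h g f
  simp only [mul_comm (lazyStep G d g _)] at h2
  rw [h, h2, sum_nbr_comm G fun u v => f v * g u]
  simp only [mul_comm]

open scoped Classical in
/-- One step contracts functions of mean zero. The laziness makes the negative part of the spectrum
harmless: the squared norm of the Laplacian of `f` is at most `d` times the energy of `f`. -/
lemma sum_lazyStep_sq_le {φ : ℝ} (hφ : 0 < φ) (hG : IsExpander φ G) (hd : 1 ≤ d)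
    (hdeg : ∀ u, deg G u ≤ d) {f : W → ℝ} (hf : ∑ u, f u = 0) :
    ∑ u, lazyStep G d f u ^ 2 ≤ (1 - φ ^ 2 / (16 * d ^ 2)) * ∑ u, f u ^ 2 := by
  have hd0 : (0 : ℝ) < d := by exact_mod_cast hd
  have hch := cheeger hφ hG hd hdeg hf
  set N := ∑ u, f u ^ 2 with hN
  set D := ∑ u, ∑ v ∈ G.neighborFinset u, (f u - f v) ^ 2 with hD
  let g : W → ℝ := fun u => ∑ v ∈ G.neighborFinset u, (f u - f v)
  have h1 : ∑ u, f u * g u = D / 2 := by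
    have e1 : ∑ u, f u * g u = ∑ u, ∑ v ∈ G.neighborFinset u, f u * (f u - f v) := by
      simp only [g, Finset.mul_sum]
    have e2 := sum_nbr_comm G fun u v => f u * (f u - f v)
    have e3 : D = ∑ u, ∑ v ∈ G.neighborFinset u, f u * (f u - f v) +
        ∑ u, ∑ v ∈ G.neighborFinset u, f v * (f v - f u) := by
      simp only [hD, ← Finset.sum_add_distrib]
      refine Finset.sum_congr rfl fun u _ => Finset.sum_congr rfl fun v _ => ?_
      ring
    linarith
  have h2 : ∑ u, g u ^ 2 ≤ d * D := by
    rw [hD, Finset.mul_sum]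
    refine Finset.sum_le_sum fun u _ => ?_
    refine (sq_sum_le_card_mul_sum_sq).trans ?_
    exact mul_le_mul_of_nonneg_right (by exact_mod_cast hdeg u)
      (Finset.sum_nonneg fun _ _ => sq_nonneg _)
  have h3 : ∑ u, lazyStep G d f u ^ 2 = N - (∑ u, f u * g u) / d +
      (∑ u, g u ^ 2) / (4 * d ^ 2) := by
    rw [hN, Finset.sum_div, Finset.sum_div, ← Finset.sum_sub_distrib, ← Finset.sum_add_distrib]
    refine Finset.sum_congr rfl fun u _ => ?_
    rw [lazyStep_eq hd hdeg]
    simp only [g]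
    field_simp
    ring
  have h4 : (∑ u, g u ^ 2) / (4 * d ^ 2) ≤ D / (4 * d) := by
    calc (∑ u, g u ^ 2) / (4 * d ^ 2) ≤ d * D / (4 * d ^ 2) := by gcongr
      _ = D / (4 * d) := by field_simp
  have h5 : φ ^ 2 / (16 * d ^ 2) * N ≤ D / (4 * d) := by
    calc φ ^ 2 / (16 * d ^ 2) * N = (φ ^ 2 / (4 * d) * N) / (4 * d) := by field_simp; ring
      _ ≤ D / (4 * d) := by gcongr
  have h6 : D / 2 / d = 2 * (D / (4 * d)) := by field_simp; ring
  rw [h3, h1, h6]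
  linarith

lemma lazyStep_pow_succ (i : ℕ) (f : W → ℝ) :
    (lazyStep G d ^ (i + 1)) f = (lazyStep G d ^ i) (lazyStep G d f) := by
  rw [pow_succ, Module.End.mul_apply]

lemma lazyStep_pow_one (hd : 1 ≤ d) (i : ℕ) : (lazyStep G d ^ i) 1 = 1 := by
  induction i with
  | zero => simp
  | succ i ih => rw [lazyStep_pow_succ, lazyStep_one hd, ih]

lemma lazyStep_pow_nonneg (i : ℕ) {f : W → ℝ} (hf : ∀ u, 0 ≤ f u) (u : W) :
    0 ≤ (lazyStep G d ^ i) f u := by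
  induction i generalizing f with
  | zero => simpa using hf u
  | succ i ih => rw [lazyStep_pow_succ]; exact ih fun v => lazyStep_nonneg hf v

lemma sum_lazyStep_pow_mul (hd : 1 ≤ d) (hdeg : ∀ u, deg G u ≤ d) (i : ℕ) (f g : W → ℝ) :
    ∑ u, (lazyStep G d ^ i) f u * g u = ∑ u, f u * (lazyStep G d ^ i) g u := by
  induction i generalizing f g with
  | zero => simp
  | succ i ih =>
    rw [lazyStep_pow_succ, ih, sum_lazyStep_mul hd hdeg, pow_succ', Module.End.mul_apply]

lemma sum_lazyStep_pow (hd : 1 ≤ d) (hdeg : ∀ u, deg G u ≤ d) (i : ℕ) (f : W → ℝ) :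
    ∑ u, (lazyStep G d ^ i) f u = ∑ u, f u := by
  simpa [lazyStep_pow_one hd] using sum_lazyStep_pow_mul hd hdeg i f 1

lemma sum_lazyStep_pow_sq_le {φ : ℝ} (hφ : 0 < φ) (hG : IsExpander φ G) (hd : 1 ≤ d)
    (hdeg : ∀ u, deg G u ≤ d) {κ : ℝ} (hκ : 0 ≤ κ) (hκ' : 1 - φ ^ 2 / (16 * d ^ 2) ≤ κ) (i : ℕ)
    {f : W → ℝ} (hf : ∑ u, f u = 0) :
    ∑ u, (lazyStep G d ^ i) f u ^ 2 ≤ κ ^ i * ∑ u, f u ^ 2 := by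
  induction i generalizing f with
  | zero => simp
  | succ i ih =>
    rw [lazyStep_pow_succ]
    have h1 : ∑ u, lazyStep G d f u = 0 := by
      simpa [hf] using sum_lazyStep_pow hd hdeg 1 f
    refine (ih h1).trans ?_
    rw [pow_succ, mul_assoc]
    refine mul_le_mul_of_nonneg_left ?_ (by positivity)
    exact (sum_lazyStep_sq_le hφ hG hd hdeg hf).trans
      (mul_le_mul_of_nonneg_right hκ' (Finset.sum_nonneg fun _ _ => sq_nonneg _))

open scoped Classical in
/-- The probability that the lazy walk from `u` is at `v` after `i` steps. -/
noncomputable def walkProb (G : SimpleGraph W) (d i : ℕ) (u v : W) : ℝ :=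
  (lazyStep G d ^ i) (Pi.single v 1) u

lemma walkProb_nonneg (i : ℕ) (u v : W) : 0 ≤ walkProb G d i u v := by
  classical
  refine lazyStep_pow_nonneg i (fun u => ?_) u
  rw [Pi.single_apply]
  split_ifs <;> norm_num

open scoped Classical in
lemma sum_walkProb_right (hd : 1 ≤ d) (i : ℕ) (u : W) : ∑ v, walkProb G d i u v = 1 := by
  simp only [walkProb]
  rw [← Finset.sum_apply u Finset.univ fun v => (lazyStep G d ^ i) (Pi.single v 1), ← map_sum]
  have h : ∑ v : W, (Pi.single v 1 : W → ℝ) = 1 := by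
    ext u
    simp [Finset.sum_apply, Pi.single_apply]
  rw [h, lazyStep_pow_one hd, Pi.one_apply]

lemma sum_walkProb_mul (hd : 1 ≤ d) (hdeg : ∀ u, deg G u ≤ d) (i : ℕ) (x : W → ℝ) (v : W) :
    ∑ u, walkProb G d i u v * x u = (lazyStep G d ^ i) x v := by
  classical
  simp only [walkProb]
  rw [sum_lazyStep_pow_mul hd hdeg]
  simp [Pi.single_apply]

lemma sum_walkProb_left (hd : 1 ≤ d) (hdeg : ∀ u, deg G u ≤ d) (i : ℕ) (v : W) :
    ∑ u, walkProb G d i u v = 1 := by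
  simpa [lazyStep_pow_one hd] using sum_walkProb_mul hd hdeg i 1 v

/-- After sufficiently many steps, the walk is at every node with at least half the uniform
probability. -/
lemma le_walkProb {φ : ℝ} (hφ : 0 < φ) (hG : IsExpander φ G) (hd : 1 ≤ d)
    (hdeg : ∀ u, deg G u ≤ d) {κ : ℝ} (hκ : 0 ≤ κ) (hκ' : 1 - φ ^ 2 / (16 * d ^ 2) ≤ κ) {i : ℕ}
    (hi : κ ^ i ≤ (1 / (2 * Fintype.card W)) ^ 2) (u v : W) :
    1 / (2 * Fintype.card W) ≤ walkProb G d i u v := by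
  classical
  have hne : Nonempty W := ⟨u⟩
  have hm : (0 : ℝ) < Fintype.card W := by exact_mod_cast Fintype.card_pos
  let m : ℝ := Fintype.card W
  let f : W → ℝ := Pi.single v 1 - (1 / m) • 1
  have hf : ∑ u, f u = 0 := by
    simp [f, m, Pi.single_apply]
  have hf2 : ∑ u, f u ^ 2 ≤ 1 := by
    have : ∀ u, f u ^ 2 = (Pi.single v 1 : W → ℝ) u * (1 - 1 / m) - 1 / m * f u := fun u => by
      simp only [f, Pi.sub_apply, Pi.smul_apply, Pi.one_apply, smul_eq_mul, Pi.single_apply]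
      split_ifs <;> ring
    simp only [this, Finset.sum_sub_distrib, ← Finset.sum_mul, ← Finset.mul_sum, hf]
    have : 0 ≤ 1 / m := by positivity
    simp [Pi.single_apply]
    simpa using this
  have h1 := sum_lazyStep_pow_sq_le hφ hG hd hdeg hκ hκ' i hf
  have h2 : (lazyStep G d ^ i) f u = walkProb G d i u v - 1 / m := by
    simp only [f, map_sub, map_smul, lazyStep_pow_one hd, walkProb]
    simp
  have h3 : (walkProb G d i u v - 1 / m) ^ 2 ≤ (1 / (2 * m)) ^ 2 := by
    rw [← h2]
    calc _ ≤ ∑ u, (lazyStep G d ^ i) f u ^ 2 :=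
          Finset.single_le_sum (f := fun u => (lazyStep G d ^ i) f u ^ 2)
            (fun _ _ => sq_nonneg _) (Finset.mem_univ u)
      _ ≤ κ ^ i * 1 := h1.trans (mul_le_mul_of_nonneg_left hf2 (by positivity))
      _ ≤ _ := by rw [mul_one]; exact hi
  have h4 := abs_le_of_sq_le_sq' h3 (by positivity)
  have h5 : 1 / m = 1 / (2 * m) + 1 / (2 * m) := by field_simp; norm_num
  change 1 / (2 * m) ≤ _
  linarith [h4.1]

end LazyWalk

/-! ### Scheduling the walks of a phase -/

lemma choice_eq_some {W : Type*} {d ℓ : ℕ} (coins : PhaseCoins W d ℓ) {σ : WalkState W}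
    {τ : Token W} (h : (σ τ).2 < ℓ) :
    choice coins σ τ = some (coins τ ⟨(σ τ).2, h⟩).val := by
  rw [choice, dif_pos h]

section Schedule

variable {W : Type*} [Fintype W] {d ℓ : ℕ}

/-- The node of a walk from `u` with choices `c` after `i` steps. It does not depend on the rounds
in which the steps are made. -/
noncomputable def walkPos (G : SimpleGraph W) (c : Fin ℓ → Fin (2 * d)) (u : W) : ℕ → W
  | 0 => u
  | i + 1 => if h : i < ℓ then (port G (walkPos G c u i) (c ⟨i, h⟩)).getD (walkPos G c u i)
      else walkPos G c u i

variable {G : SimpleGraph W}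

lemma walkPos_succ (c : Fin ℓ → Fin (2 * d)) (u : W) {i : ℕ} (h : i < ℓ) :
    walkPos G c u (i + 1) = (port G (walkPos G c u i) (c ⟨i, h⟩)).getD (walkPos G c u i) := by
  rw [walkPos, dif_pos h]

lemma walkPos_update (c : Fin ℓ → Fin (2 * d)) (u : W) (k : Fin ℓ) (p : Fin (2 * d)) {i : ℕ}
    (hi : i ≤ k) : walkPos G (Function.update c k p) u i = walkPos G c u i := by
  induction i with
  | zero => rfl
  | succ i ih =>
    have h : i < ℓ := lt_of_lt_of_le hi k.2.le
    rw [walkPos_succ _ _ h, walkPos_succ _ _ h, ih (by omega), Function.update_of_ne]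
    exact Fin.ne_of_lt hi

lemma expect_walkPos (hd : 1 ≤ d) (f : W → ℝ) (u : W) {i : ℕ} (hi : i ≤ ℓ) :
    𝔼 c : Fin ℓ → Fin (2 * d), f (walkPos G c u i) = (lazyStep G d ^ i) f u := by
  have : NeZero (2 * d) := ⟨by omega⟩
  induction i generalizing f with
  | zero => simp [walkPos]
  | succ i ih =>
    rw [← expect_update _ ⟨i, hi⟩, lazyStep_pow_succ, ← ih _ (by omega)]
    refine Finset.expect_congr rfl fun c _ => ?_
    rw [lazyStep_apply]
    refine Finset.expect_congr rfl fun p _ => ?_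
    rw [walkPos_succ _ _ hi, walkPos_update _ _ _ _ le_rfl, Function.update_self]

variable (coins : PhaseCoins W d ℓ)

lemma roundStep_cases (r : ℕ) (σ : WalkState W) (τ : Token W) :
    roundStep G coins r σ τ = σ τ ∨ ∃ h : (σ τ).2 < ℓ, roundStep G coins r σ τ =
      ((port G (σ τ).1 (coins τ ⟨(σ τ).2, h⟩)).getD (σ τ).1, (σ τ).2 + 1) := by
  by_cases h : (σ τ).2 < ℓ
  · rw [roundStep, choice_eq_some coins h]
    cases hp : port G (σ τ).1 (coins τ ⟨(σ τ).2, h⟩) with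
    | none => right; exact ⟨h, by simp [hp]⟩
    | some v =>
      simp only [hp]
      split_ifs with hs
      · right; exact ⟨h, by simp⟩
      · left; trivial
  · left
    rw [roundStep, choice, dif_neg h]

lemma roundStep_of_none (r : ℕ) {σ : WalkState W} {τ : Token W} (h : (σ τ).2 < ℓ)
    (hp : port G (σ τ).1 (coins τ ⟨(σ τ).2, h⟩) = none) :
    (roundStep G coins r σ τ).2 = (σ τ).2 + 1 := by
  rw [roundStep, choice_eq_some coins h]
  simp [hp]

lemma roundStep_of_sent (r : ℕ) {σ : WalkState W} {τ : Token W} (h : (σ τ).2 < ℓ)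
    (hs : sent G coins r σ (σ τ).1 = some τ) :
    (roundStep G coins r σ τ).2 = (σ τ).2 + 1 := by
  rw [roundStep, choice_eq_some coins h]
  cases hp : port G (σ τ).1 (coins τ ⟨(σ τ).2, h⟩) with
  | none => simp [hp]
  | some v => simp [hp, hs]

/-- Whatever the schedule, a walk that has made `i` steps is at its `i`-th node. -/
lemma walkState_spec (r : ℕ) (τ : Token W) :
    (walkState G coins r τ).1 = walkPos G (coins τ) τ.2 (walkState G coins r τ).2 ∧
      (walkState G coins r τ).2 ≤ ℓ := by
  induction r with
  | zero => simp [walkState, walkPos]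
  | succ r ih =>
    rw [walkState]
    rcases roundStep_cases (G := G) coins r (walkState G coins r) τ with h | ⟨hlt, h⟩
    · rw [h]; exact ih
    · rw [h]
      refine ⟨?_, hlt⟩
      rw [walkPos_succ _ _ hlt, ← ih.1]

lemma walkState_le_succ (r : ℕ) (τ : Token W) :
    (walkState G coins r τ).2 ≤ (walkState G coins (r + 1) τ).2 := by
  rw [walkState]
  rcases roundStep_cases (G := G) coins r (walkState G coins r) τ with h | ⟨_, h⟩ <;> rw [h]
  exact Nat.le_succ _

lemma walkState_mono (τ : Token W) : Monotone fun r => (walkState G coins r τ).2 :=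
  monotone_nat_of_le_succ fun r => walkState_le_succ coins r τ

open scoped Classical in
lemma exists_sent {r : ℕ} {σ : WalkState W} {u : W} (hp : (port G u (r % d)).isSome)
    (hw : (waiting coins σ u (r % d)).Nonempty) :
    ∃ τ ∈ waiting coins σ u (r % d), sent G coins r σ u = some τ ∧
      ∀ τ' ∈ waiting coins σ u (r % d), (σ τ).2 ≤ (σ τ').2 := by
  have hspec := Classical.choose_spec
    (Finset.exists_min_image (waiting coins σ u (r % d)) (fun τ => (σ τ).2) hw)
  exact ⟨_, hspec.1, by rw [sent, dif_pos ⟨hp, hw⟩], hspec.2⟩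

open scoped Classical in
/-- The walks that have made exactly `i` steps after `r` rounds and are to move next from `u`
by choice `p`. -/
noncomputable def pending (G : SimpleGraph W) (i : Fin ℓ) (u : W) (p : Fin (2 * d)) (r : ℕ) :
    Finset (Token W) :=
  {τ | (walkState G coins r τ).2 = i ∧ walkPos G (coins τ) τ.2 i = u ∧ coins τ i = p}

variable {coins}

lemma mem_pending {i : Fin ℓ} {u : W} {p : Fin (2 * d)} {r : ℕ} {τ : Token W} :
    τ ∈ pending coins G i u p r ↔ (walkState G coins r τ).2 = i ∧
      walkPos G (coins τ) τ.2 i = u ∧ coins τ i = p := by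
  simp [pending]

lemma pending_succ_subset {i : Fin ℓ} {r : ℕ} (hr : ∀ τ, i ≤ (walkState G coins r τ).2)
    (u : W) (p : Fin (2 * d)) : pending coins G i u p (r + 1) ⊆ pending coins G i u p r := by
  intro τ hτ
  rw [mem_pending] at hτ ⊢
  exact ⟨le_antisymm (hτ.1 ▸ walkState_le_succ coins r τ) (hr τ), hτ.2⟩

/-- Once all walks have made at least `i` steps, the walks with exactly `i` steps have priority. So
in a round in which a node contacts neighbour number `p`, one of those pending there advances. -/
lemma card_pending_succ (hdeg : ∀ u, deg G u ≤ d) {i : Fin ℓ} {r : ℕ}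
    (hr : ∀ τ, i ≤ (walkState G coins r τ).2) (u : W) {p : Fin (2 * d)} (hp : r % d = p % d) :
    (pending coins G i u p (r + 1)).card ≤ (pending coins G i u p r).card - 1 := by
  have hsub := pending_succ_subset hr u p
  rcases (pending coins G i u p r).eq_empty_or_nonempty with h0 | ⟨τ₀, hτ₀⟩
  · rw [h0] at hsub ⊢
    simpa using hsub
  -- sets of pending walks only shrink, so it suffices that one walk leaves
  suffices ∃ τ ∈ pending coins G i u p r, (walkState G coins (r + 1) τ).2 = i + 1 by
    obtain ⟨τ, hτ, hs⟩ := this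
    have hss : pending coins G i u p (r + 1) ⊂ pending coins G i u p r := by
      refine Finset.ssubset_iff_subset_ne.2 ⟨hsub, fun he => ?_⟩
      rw [← he, mem_pending, hs] at hτ
      omega
    have := Finset.card_lt_card hss
    omega
  have hstate : ∀ τ ∈ pending coins G i u p r, ∃ h : (walkState G coins r τ).2 < ℓ,
      (walkState G coins r τ).1 = u ∧ coins τ ⟨(walkState G coins r τ).2, h⟩ = p := fun τ hτ => by
    obtain ⟨h1, h2, h3⟩ := mem_pending.1 hτ
    refine ⟨h1 ▸ i.2, ?_, ?_⟩
    · rw [(walkState_spec coins r τ).1, h1, h2]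
    · rw [← h3]; congr 1; exact Fin.ext h1
  obtain ⟨hlt, hu, hc⟩ := hstate τ₀ hτ₀
  have hi₀ := (mem_pending.1 hτ₀).1
  cases hport : port G u p with
  | none =>
    -- a staying step is made in any round
    refine ⟨τ₀, hτ₀, ?_⟩
    rw [walkState, roundStep_of_none coins r hlt (by rw [hu, hc, hport]), hi₀]
  | some v =>
    have hpd : (p : ℕ) < d := by
      by_contra hge
      rw [port, dif_neg fun h => hge (h.trans_le (hdeg u))] at hport
      exact absurd hport (by simp)
    have hrp : r % d = p := by rw [hp, Nat.mod_eq_of_lt hpd]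
    have hw : τ₀ ∈ waiting coins (walkState G coins r) u (r % d) := by
      simp [waiting, hu, choice_eq_some coins hlt, hc, hrp]
    obtain ⟨τ, hτw, hsent, hmin⟩ := exists_sent (G := G) coins (by rw [hrp, hport]; rfl) ⟨τ₀, hw⟩
    have hτi : (walkState G coins r τ).2 = i := le_antisymm (hi₀ ▸ hmin τ₀ hw) (hr τ)
    have hτlt : (walkState G coins r τ).2 < ℓ := hτi ▸ i.2
    simp only [waiting, Finset.mem_filter, Finset.mem_univ, true_and] at hτw
    rw [choice_eq_some coins hτlt, hrp, Option.some_inj] at hτw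
    refine ⟨τ, mem_pending.2 ⟨hτi, ?_, ?_⟩, ?_⟩
    · rw [← hτw.1, (walkState_spec coins r τ).1, hτi]
    · rw [← Fin.ext hτw.2]; congr 1; exact Fin.ext hτi.symm
    · rw [walkState, roundStep_of_sent coins r hτlt (by rw [hτw.1, hsent]), hτi]

/-- Every node and port is served once in `d` consecutive rounds. -/
lemma card_pending_add_le (hd : 1 ≤ d) (hdeg : ∀ u, deg G u ≤ d) {i : Fin ℓ} {r : ℕ}
    (hr : ∀ τ, i ≤ (walkState G coins r τ).2) (u : W) (p : Fin (2 * d)) (q : ℕ) :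
    (pending coins G i u p (r + q * d)).card ≤ (pending coins G i u p r).card - q := by
  have hr' : ∀ s τ, i ≤ (walkState G coins (r + s) τ).2 := fun s τ =>
    (hr τ).trans (walkState_mono coins τ (Nat.le_add_right r s))
  have hmono : ∀ s s', s ≤ s' → (pending coins G i u p (r + s')).card ≤
      (pending coins G i u p (r + s)).card := by
    intro s s' h
    induction s', h using Nat.le_induction with
    | base => exact le_rfl
    | succ s' _ ih => exact (Finset.card_le_card (pending_succ_subset (hr' s') u p)).trans ih
  induction q with
  | zero => simp
  | succ q ih =>
    obtain ⟨k, hk, hmod⟩ : ∃ k < d, (r + q * d + k) % d = p % d := by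
      have hlt := Nat.mod_lt (r + q * d) hd
      refine ⟨(p + (d - (r + q * d) % d)) % d, Nat.mod_lt _ hd, ?_⟩
      rw [Nat.add_mod_mod, ← Nat.mod_add_mod,
        show (r + q * d) % d + (p + (d - (r + q * d) % d)) = p + d by omega,
        Nat.add_mod_right]
    have h1 := card_pending_succ hdeg (hr' (q * d + k)) u (p := p) (by rw [← hmod, add_assoc])
    have h2 := hmono (q * d + k + 1) ((q + 1) * d) (by rw [add_mul]; omega)
    have h3 := hmono (q * d) (q * d + k) (by omega)
    rw [← add_assoc] at h2
    omega

open scoped Classical in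
/-- If no node holds more than `L` walks at any step, all walks end within `ℓ * (L * d)` rounds. -/
lemma destination_eq_walkPos (hd : 1 ≤ d) (hdeg : ∀ u, deg G u ≤ d) {L : ℕ}
    (hL : ∀ i < ℓ, ∀ v, (Finset.univ.filter fun τ : Token W =>
      walkPos G (coins τ) τ.2 i = v).card ≤ L) (τ : Token W) :
    destination G coins (ℓ * (L * d)) τ = walkPos G (coins τ) τ.2 ℓ := by
  have key : ∀ i ≤ ℓ, ∀ τ, i ≤ (walkState G coins (i * (L * d)) τ).2 := by
    intro i hi
    induction i with
    | zero => simp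
    | succ i ih =>
      intro τ
      have hr := ih (by omega)
      by_contra hlt
      have hge := (hr τ).trans (walkState_mono coins τ
        (show i * (L * d) ≤ (i + 1) * (L * d) by gcongr; omega))
      have hmem : τ ∈ pending coins G ⟨i, hi⟩ (walkPos G (coins τ) τ.2 i) (coins τ ⟨i, hi⟩)
          (i * (L * d) + L * d) :=
        mem_pending.2
          ⟨by rw [← Nat.succ_mul]; simp only [Nat.succ_eq_add_one] at *; omega, rfl, rfl⟩
      have h1 := card_pending_add_le hd hdeg (i := ⟨i, hi⟩) hr (walkPos G (coins τ) τ.2 i)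
        (coins τ ⟨i, hi⟩) L
      have h2 : (pending coins G ⟨i, hi⟩ (walkPos G (coins τ) τ.2 i) (coins τ ⟨i, hi⟩)
          (i * (L * d))).card ≤ L := by
        refine le_trans (Finset.card_le_card fun τ' hτ' => ?_) (hL i hi (walkPos G (coins τ) τ.2 i))
        simpa using (mem_pending.1 hτ').2.1
      have h3 := Finset.card_pos.2 ⟨τ, hmem⟩
      omega
  have hs := walkState_spec (G := G) coins (ℓ * (L * d)) τ
  rw [destination, hs.1, le_antisymm hs.2 (key ℓ le_rfl τ)]

end Schedule

/-! ### One phase -/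

section PushStep

variable {W : Type*} [Fintype W]

open scoped Classical in
/-- One phase of push-sum: every node keeps one half and sends the other half to `D u`. -/
noncomputable def pushStep {M : Type*} [AddCommGroup M] [Module ℝ M] (D : W → W) (x : W → M)
    (v : W) : M :=
  (1 / 2 : ℝ) • x v + ∑ u ∈ Finset.univ.filter (fun u => D u = v), (1 / 2 : ℝ) • x u

variable [DecidableEq W]

lemma pushStep_real (D : W → W) (x : W → ℝ) (v : W) :
    pushStep D x v = (x v + ∑ u, if D u = v then x u else 0) / 2 := by
  rw [pushStep, ← Finset.sum_filter, ← Finset.smul_sum]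
  simp only [smul_eq_mul]
  ring_nf
  congr!

lemma sum_pushStep (D : W → W) (x : W → ℝ) : ∑ v, pushStep D x v = ∑ v, x v := by
  simp only [pushStep_real, ← Finset.sum_div, Finset.sum_add_distrib]
  rw [Finset.sum_comm]
  simp

lemma sum_pushStep_sq_le (D : W → W) (x : W → ℝ) :
    ∑ v, pushStep D x v ^ 2 ≤ Fintype.card W * ∑ v, x v ^ 2 := by
  rcases isEmpty_or_nonempty W with h0 | h0
  · simp
  have hm : (1 : ℝ) ≤ Fintype.card W := by exact_mod_cast Fintype.card_pos
  have h1 : ∀ v, (∑ u, if D u = v then x u else 0) ^ 2 ≤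
      Fintype.card W * ∑ u, if D u = v then x u ^ 2 else 0 := fun v => by
    refine sq_sum_le_card_mul_sum_sq.trans (le_of_eq ?_)
    simp [ite_pow]
  have h2 : ∑ v, ∑ u, (if D u = v then x u ^ 2 else 0) = ∑ u, x u ^ 2 := by
    rw [Finset.sum_comm]
    simp
  have h3 : ∑ v, (∑ u, if D u = v then x u else 0) ^ 2 ≤ Fintype.card W * ∑ u, x u ^ 2 := by
    rw [← h2, Finset.mul_sum]
    exact Finset.sum_le_sum fun v _ => h1 v
  have h4 : ∑ v, pushStep D x v ^ 2 ≤
      (∑ v, x v ^ 2 + ∑ v, (∑ u, if D u = v then x u else 0) ^ 2) / 2 := by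
    rw [← Finset.sum_add_distrib, Finset.sum_div]
    refine Finset.sum_le_sum fun v _ => ?_
    rw [pushStep_real]
    nlinarith [sq_nonneg (x v - ∑ u, if D u = v then x u else 0)]
  have h5 : ∑ v, x v ^ 2 ≤ Fintype.card W * ∑ v, x v ^ 2 :=
    le_mul_of_one_le_left (Finset.sum_nonneg fun _ _ => sq_nonneg _) hm
  linarith

end PushStep

lemma token_injective {W : Type*} (b : Bool) : Function.Injective fun u : W => ((b, u) : Token W) :=
  fun _ _ h => (Prod.mk.inj h).2

section Phase

variable {W : Type*} [Fintype W] [DecidableEq W] {d ℓ : ℕ}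

/-- Some node holds more than `L` walks after the same number of steps. -/
def Congested (G : SimpleGraph W) (L : ℕ) (coins : PhaseCoins W d ℓ) : Prop :=
  ∃ x : Fin ℓ × W, L < (Finset.univ.filter fun τ : Token W =>
    walkPos G (coins τ) τ.2 x.1 = x.2).card

variable {G : SimpleGraph W}

lemma expect_ite_walkPos (hd : 1 ≤ d) (u v : W) {i : ℕ} (hi : i ≤ ℓ) (a : ℝ) :
    𝔼 c : Fin ℓ → Fin (2 * d), (if walkPos G c u i = v then a else 0) = walkProb G d i u v * a := by
  have h := expect_walkPos (G := G) hd (Pi.single v 1) u hi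
  have h2 : walkProb G d i u v = (lazyStep G d ^ i) (Pi.single v 1) u := by
    rw [walkProb]; congr!
  rw [h2, ← h, Finset.expect_mul]
  refine Finset.expect_congr rfl fun c _ => ?_
  simp [Pi.single_apply]

/-- The number of walks at a node after `i` steps is a sum of independent indicators of mean `2`;
this is the Chernoff bound for its exponential moment. -/
lemma frac_congested_le (hd : 1 ≤ d) (hdeg : ∀ u, deg G u ≤ d) (L : ℕ) :
    frac (Congested (d := d) (ℓ := ℓ) G L) ≤ ℓ * Fintype.card W * (Real.exp 2 / 2 ^ L) := by
  have : NeZero (2 * d) := ⟨by omega⟩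
  refine (frac_exists_le _).trans ?_
  have h : ∀ x : Fin ℓ × W, frac (fun coins : PhaseCoins W d ℓ =>
      L < (Finset.univ.filter fun τ : Token W => walkPos G (coins τ) τ.2 x.1 = x.2).card) ≤
      Real.exp 2 / 2 ^ L := by
    rintro ⟨i, v⟩
    let g : Token W → (Fin ℓ → Fin (2 * d)) → ℝ := fun τ c =>
      1 + if walkPos G c τ.2 i = v then 1 else 0
    have hg : ∀ coins : PhaseCoins W d ℓ, ∏ τ, g τ (coins τ) =
        2 ^ (Finset.univ.filter fun τ : Token W => walkPos G (coins τ) τ.2 i = v).card := by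
      intro coins
      have : ∀ τ, g τ (coins τ) = if walkPos G (coins τ) τ.2 i = v then 2 else 1 := fun τ => by
        simp only [g]; split_ifs <;> norm_num
      simp only [this, Finset.prod_ite, Finset.prod_const, one_pow, mul_one]
    have h1 := frac_le_div (F := fun coins : PhaseCoins W d ℓ => ∏ τ, g τ (coins τ))
      (p := fun coins : PhaseCoins W d ℓ =>
        L < (Finset.univ.filter fun τ : Token W => walkPos G (coins τ) τ.2 i = v).card)
      (a := 2 ^ L) (by positivity) (fun coins => by rw [hg]; positivity) (fun coins hc => by
        rw [hg]; exact pow_le_pow_right₀ (by norm_num) hc.le)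
    refine h1.trans ?_
    gcongr
    rw [expect_prod (e := fun τ : Token W => τ) Function.injective_id]
    have h2 : ∀ τ : Token W, 𝔼 c, g τ c = 1 + walkProb G d i τ.2 v := fun τ => by
      simp only [g, Finset.expect_add_distrib, Fintype.expect_const]
      rw [expect_ite_walkPos hd _ _ i.2.le, mul_one]
    calc ∏ τ : Token W, 𝔼 c, g τ c ≤ ∏ τ : Token W, Real.exp (walkProb G d i τ.2 v) := by
          refine Finset.prod_le_prod (fun τ _ => ?_) fun τ _ => ?_
          · rw [h2]; linarith [walkProb_nonneg (G := G) (d := d) i τ.2 v]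
          · rw [h2, add_comm]; exact Real.add_one_le_exp _
      _ = Real.exp 2 := by
          rw [← Real.exp_sum, Fintype.sum_prod_type]
          simp [sum_walkProb_left hd hdeg]
  refine (Finset.sum_le_sum fun x _ => h x).trans ?_
  simp

/-- The properties of the parameters on which the analysis of one phase rests: the walks mix, and
congestion is rare. -/
structure GoodPhase (G : SimpleGraph W) (d ℓ L : ℕ) : Prop where
  /-- The degree bound is positive. -/
  one_le : 1 ≤ d
  /-- All degrees are bounded by `d`. -/
  deg_le : ∀ u, deg G u ≤ d
  /-- The transition operator of the whole walk contracts vectors of mean zero. -/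
  contract : ∀ x : W → ℝ, ∑ u, x u = 0 →
    ∑ u, (lazyStep G d ^ ℓ) x u ^ 2 ≤ 1 / 16 * ∑ u, x u ^ 2
  /-- Every node is the end of a given walk with at least half the uniform probability. -/
  lower : ∀ u v, 1 / (2 * Fintype.card W) ≤ walkProb G d ℓ u v
  /-- Congestion is too rare to matter even when it multiplies a potential by `|W|`. -/
  rare : frac (Congested (d := d) (ℓ := ℓ) G L) ≤ 1 / (16 * Fintype.card W)

lemma destination_of_not_congested {L : ℕ} (h : GoodPhase G d ℓ L) {coins : PhaseCoins W d ℓ}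
    (hc : ¬ Congested G L coins) (τ : Token W) :
    destination G coins (ℓ * (L * d)) τ = walkPos G (coins τ) τ.2 ℓ := by
  refine destination_eq_walkPos h.one_le h.deg_le (fun i hi v => ?_) τ
  have := not_lt.1 fun hlt => hc ⟨(⟨i, hi⟩, v), hlt⟩
  exact le_trans (le_of_eq (by congr!)) this

/-- Without congestion, one phase multiplies the squared norm of a vector of mean zero by at most
`2 / 3` in expectation. -/
lemma expect_sum_pushStep_walkPos_le {L : ℕ} (h : GoodPhase G d ℓ L) (b : Bool) {x : W → ℝ}
    (hx : ∑ u, x u = 0) :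
    𝔼 coins : PhaseCoins W d ℓ, ∑ v, pushStep (fun u => walkPos G (coins (b, u)) u ℓ) x v ^ 2 ≤
      2 / 3 * ∑ u, x u ^ 2 := by
  have : NeZero (2 * d) := ⟨by have := h.one_le; omega⟩
  let Z : W → W → (Fin ℓ → Fin (2 * d)) → ℝ := fun v u c => if walkPos G c u ℓ = v then x u else 0
  let y : W → ℝ := (lazyStep G d ^ ℓ) x
  have hmean : ∀ v, ∑ u, 𝔼 c, Z v u c = y v := fun v => by
    simp only [Z, expect_ite_walkPos h.one_le _ _ le_rfl]
    exact sum_walkProb_mul h.one_le h.deg_le ℓ x v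
  have hsecond : ∀ v, ∑ u, 𝔼 c, Z v u c ^ 2 = ∑ u, walkProb G d ℓ u v * x u ^ 2 := fun v => by
    refine Finset.sum_congr rfl fun u _ => ?_
    rw [← expect_ite_walkPos h.one_le _ _ le_rfl]
    simp [Z, ite_pow]
  have hmean' : ∀ v, 𝔼 coins : PhaseCoins W d ℓ, ∑ u, Z v u (coins (b, u)) = y v := fun v => by
    rw [← hmean, Finset.expect_sum_comm]
    exact Finset.sum_congr rfl fun u _ => expect_eval (Z v u) (b, u)
  have hv : ∀ v, 𝔼 coins : PhaseCoins W d ℓ,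
      pushStep (fun u => walkPos G (coins (b, u)) u ℓ) x v ^ 2 ≤
        (x v ^ 2 + (x v ^ 2 / 4 + 4 * y v ^ 2) +
          (∑ u, walkProb G d ℓ u v * x u ^ 2 + y v ^ 2)) / 4 := by
    intro v
    have h1 : ∀ coins : PhaseCoins W d ℓ,
        pushStep (fun u => walkPos G (coins (b, u)) u ℓ) x v ^ 2 =
        (x v ^ 2 + 2 * x v * ∑ u, Z v u (coins (b, u)) + (∑ u, Z v u (coins (b, u))) ^ 2) / 4 :=
      fun coins => by rw [pushStep_real]; ring
    simp only [h1, ← Finset.expect_div, Finset.expect_add_distrib, Fintype.expect_const,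
      ← Finset.mul_expect, hmean']
    have h2 := expect_sum_sq_le (token_injective b) (Z v)
    rw [hmean, hsecond] at h2
    have h3 : 2 * x v * y v ≤ x v ^ 2 / 4 + 4 * y v ^ 2 := by
      nlinarith [sq_nonneg (x v / 2 - 2 * y v)]
    gcongr
  rw [Finset.expect_sum_comm]
  refine (Finset.sum_le_sum fun v _ => hv v).trans ?_
  have h4 : ∑ v, ∑ u, walkProb G d ℓ u v * x u ^ 2 = ∑ u, x u ^ 2 := by
    rw [Finset.sum_comm]
    simp only [← Finset.sum_mul, sum_walkProb_right h.one_le, one_mul]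
  have h5 := h.contract x hx
  have h6 : 0 ≤ ∑ u, x u ^ 2 := Finset.sum_nonneg fun _ _ => sq_nonneg _
  simp only [← Finset.sum_div, Finset.sum_add_distrib, ← Finset.mul_sum, h4]
  change ∑ u, y u ^ 2 ≤ _ at h5
  linarith

/-- Congestion changes the expected contraction only slightly: a phase with congestion multiplies
the squared norm at most by the number of nodes. -/
lemma expect_sum_pushStep_le {L : ℕ} (h : GoodPhase G d ℓ L) (b : Bool) {x : W → ℝ}
    (hx : ∑ u, x u = 0) :
    𝔼 coins : PhaseCoins W d ℓ,
      ∑ v, pushStep (fun u => destination G coins (ℓ * (L * d)) (b, u)) x v ^ 2 ≤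
      3 / 4 * ∑ u, x u ^ 2 := by
  rcases isEmpty_or_nonempty W with h0 | h0
  · simp
  have hm : (0 : ℝ) < Fintype.card W := by exact_mod_cast Fintype.card_pos
  have h6 : 0 ≤ ∑ u, x u ^ 2 := Finset.sum_nonneg fun _ _ => sq_nonneg _
  have h1 := expect_le_add_frac_mul (p := Congested (d := d) (ℓ := ℓ) G L)
    (F := fun coins => ∑ v, pushStep (fun u => destination G coins (ℓ * (L * d)) (b, u)) x v ^ 2)
    (F' := fun coins => ∑ v, pushStep (fun u => walkPos G (coins (b, u)) u ℓ) x v ^ 2)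
    (fun _ => Finset.sum_nonneg fun _ _ => sq_nonneg _)
    (fun coins hc => by simp only [destination_of_not_congested h hc])
    (fun _ => sum_pushStep_sq_le _ x)
  have h2 := expect_sum_pushStep_walkPos_le h b hx
  have h3 := mul_le_mul_of_nonneg_right h.rare (mul_nonneg hm.le h6)
  have h4 : 1 / (16 * (Fintype.card W : ℝ)) * (Fintype.card W * ∑ u, x u ^ 2) =
      1 / 16 * ∑ u, x u ^ 2 := by field_simp
  linarith

end Phase

/-! ### Spreading in one phase -/

lemma one_sub_pow_le {a : ℝ} (ha : 0 ≤ a) {i : ℕ} (hi : i * a ≤ 1) (ha1 : a ≤ 1) :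
    (1 - a) ^ i ≤ 1 - i * a / 2 := by
  have h1 : (1 - a) ^ i * (1 + i * a) ≤ 1 := by
    calc (1 - a) ^ i * (1 + i * a) ≤ (1 - a) ^ i * (1 + a) ^ i := by
          have := one_add_mul_le_pow (a := a) (by linarith) i
          exact mul_le_mul_of_nonneg_left this (pow_nonneg (by linarith) _)
      _ = (1 - a ^ 2) ^ i := by rw [← mul_pow]; ring
      _ ≤ 1 := pow_le_one₀ (by nlinarith) (by nlinarith)
  have h0 : 0 ≤ i * a := by positivity
  have h2 : 1 ≤ (1 - i * a / 2) * (1 + i * a) := by nlinarith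
  exact le_of_mul_le_mul_right (h1.trans h2) (by linarith)

section Spread

variable {W : Type*} [Fintype W]

/-- A potential of nonempty node sets that vanishes only at the whole node set. (For the empty set
its value is meaningless.) -/
noncomputable def spreadPot (I : Finset W) : ℝ := Fintype.card W / I.card - 1

lemma spreadPot_anti {I J : Finset W} (hI : I.Nonempty) (h : I ⊆ J) :
    spreadPot J ≤ spreadPot I := by
  have h1 : (0 : ℝ) < I.card := by exact_mod_cast hI.card_pos
  have h2 : (I.card : ℝ) ≤ J.card := by exact_mod_cast Finset.card_le_card h
  unfold spreadPot
  gcongr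

lemma spreadPot_nonneg {I : Finset W} (hI : I.Nonempty) : 0 ≤ spreadPot I := by
  have h1 : (0 : ℝ) < I.card := by exact_mod_cast hI.card_pos
  rw [spreadPot, sub_nonneg, le_div_iff₀ h1, one_mul]
  exact_mod_cast Finset.card_le_univ I

lemma le_spreadPot {I : Finset W} (hI : I.Nonempty) (h : I ≠ Finset.univ) :
    1 / Fintype.card W ≤ spreadPot I := by
  have h1 : (0 : ℝ) < I.card := by exact_mod_cast hI.card_pos
  have h2 : I.card + 1 ≤ Fintype.card W := by
    obtain ⟨x, hx⟩ : ∃ x, x ∉ I := by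
      by_contra hcon
      push Not at hcon
      exact h (Finset.eq_univ_iff_forall.2 hcon)
    exact Finset.card_lt_univ_of_notMem hx
  have h3 : (I.card : ℝ) + 1 ≤ Fintype.card W := by exact_mod_cast h2
  rw [spreadPot, le_sub_iff_add_le, le_div_iff₀ h1, add_mul, one_mul, div_mul_eq_mul_div, one_mul]
  have : (I.card : ℝ) / Fintype.card W ≤ 1 := by
    rw [div_le_one (by linarith)]; linarith
  linarith

variable [DecidableEq W] {d ℓ : ℕ}

/-- The set reached from `I` in one phase of push-sum. -/
def spreadStep {W : Type*} [DecidableEq W] (D : W → W) (I : Finset W) : Finset W :=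
  I ∪ I.image D

/-- The reciprocal of the size of the reached set is bounded by a linear function of the number of
new nodes, because there are at most as many new nodes as old ones. -/
lemma spreadPot_spreadStep_le (D : W → W) {I : Finset W} (hI : I.Nonempty) :
    spreadPot (spreadStep D I) ≤ spreadPot I - Fintype.card W / (2 * (I.card : ℝ) ^ 2) *
      ∑ y ∈ Iᶜ, (1 - ∏ u ∈ I, (1 - if D u = y then (1 : ℝ) else 0)) := by
  have hX : ∑ y ∈ Iᶜ, (1 - ∏ u ∈ I, (1 - if D u = y then (1 : ℝ) else 0)) =
      (I.image D \ I).card := by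
    have h1 : ∀ y, 1 - ∏ u ∈ I, (1 - if D u = y then (1 : ℝ) else 0) =
        if y ∈ I.image D then 1 else 0 := fun y => by
      split_ifs with hy
      · obtain ⟨u, hu, rfl⟩ := Finset.mem_image.1 hy
        rw [Finset.prod_eq_zero hu (by simp), sub_zero]
      · rw [Finset.prod_eq_one, sub_self]
        intro u hu
        rw [if_neg (fun h : D u = y => hy (h ▸ Finset.mem_image_of_mem D hu)), sub_zero]
    simp only [h1, Finset.sum_boole]
    congr 2
    ext y
    simp only [Finset.mem_filter, Finset.mem_compl, Finset.mem_sdiff]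
    tauto
  have hcard : (spreadStep D I).card = I.card + (I.image D \ I).card := by
    rw [spreadStep, ← Finset.union_sdiff_self_eq_union, Finset.card_union_of_disjoint
      Finset.disjoint_sdiff]
  have hle : (I.image D \ I).card ≤ I.card :=
    (Finset.card_le_card Finset.sdiff_subset).trans Finset.card_image_le
  have hi : (0 : ℝ) < I.card := by exact_mod_cast hI.card_pos
  have hle' : ((I.image D \ I).card : ℝ) ≤ I.card := by exact_mod_cast hle
  rw [hX, spreadPot, spreadPot, hcard]
  push_cast
  set i : ℝ := (I.card : ℝ)
  set X : ℝ := ((I.image D \ I).card : ℝ)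
  have hX0 : 0 ≤ X := Nat.cast_nonneg _
  have h3 : 1 / (i + X) ≤ 1 / i - X / (2 * i ^ 2) := by
    have : 1 / i - X / (2 * i ^ 2) = (2 * i - X) / (2 * i ^ 2) := by field_simp
    rw [this, div_le_div_iff₀ (by positivity) (by positivity)]
    nlinarith
  have h4 := mul_le_mul_of_nonneg_left h3 (Nat.cast_nonneg (α := ℝ) (Fintype.card W))
  calc (Fintype.card W : ℝ) / (i + X) - 1 = Fintype.card W * (1 / (i + X)) - 1 := by ring
    _ ≤ Fintype.card W * (1 / i - X / (2 * i ^ 2)) - 1 := by linarith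
    _ = _ := by ring

variable {G : SimpleGraph W}

/-- Without congestion, the expected number of new nodes is at least
`|I| (|W| - |I|) / (4 |W|)`, which lowers the potential of `I` by one eighth in expectation. -/
lemma expect_spreadPot_walkPos_le {L : ℕ} (h : GoodPhase G d ℓ L) (b : Bool) {I : Finset W}
    (hI : I.Nonempty) :
    𝔼 coins : PhaseCoins W d ℓ, spreadPot (spreadStep (fun u => walkPos G (coins (b, u)) u ℓ) I) ≤
      7 / 8 * spreadPot I := by
  have : NeZero (2 * d) := ⟨by have := h.one_le; omega⟩
  obtain ⟨x₀, hx₀⟩ := hI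
  have hI : I.Nonempty := ⟨x₀, hx₀⟩
  have hne : Nonempty W := ⟨x₀⟩
  have hm : (1 : ℝ) ≤ Fintype.card W := by exact_mod_cast Fintype.card_pos
  have hi : (0 : ℝ) < I.card := by exact_mod_cast hI.card_pos
  have him : (I.card : ℝ) ≤ Fintype.card W := by exact_mod_cast Finset.card_le_univ I
  refine (Finset.expect_le_expect fun coins _ => spreadPot_spreadStep_le _ hI).trans ?_
  rw [Finset.expect_sub_distrib, Fintype.expect_const, ← Finset.mul_expect,
    Finset.expect_sum_comm]
  have hy : ∀ y, (I.card : ℝ) / (4 * Fintype.card W) ≤ 𝔼 coins : PhaseCoins W d ℓ,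
      (1 - ∏ u ∈ I, (1 - if walkPos G (coins (b, u)) u ℓ = y then (1 : ℝ) else 0)) := by
    intro y
    rw [Finset.expect_sub_distrib, Fintype.expect_const,
      expect_prod (token_injective b) I
        fun u c => (1 - if walkPos G c u ℓ = y then (1 : ℝ) else 0)]
    simp only [Finset.expect_sub_distrib, Fintype.expect_const,
      expect_ite_walkPos h.one_le _ _ le_rfl, mul_one]
    have h1 : ∏ u ∈ I, (1 - walkProb G d ℓ u y) ≤ (1 - 1 / (2 * Fintype.card W)) ^ I.card := by
      rw [← Finset.prod_const]
      refine Finset.prod_le_prod (fun u _ => ?_) fun u _ => by linarith [h.lower u y]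
      have := Finset.single_le_sum (f := fun v => walkProb G d ℓ u v)
        (fun v _ => walkProb_nonneg ℓ u v) (Finset.mem_univ y)
      rw [sum_walkProb_right h.one_le] at this
      linarith
    have h2 : (1 - 1 / (2 * (Fintype.card W : ℝ))) ^ I.card ≤
        1 - I.card * (1 / (2 * (Fintype.card W : ℝ))) / 2 := by
      refine one_sub_pow_le (by positivity) ?_ ?_
      · rw [mul_one_div, div_le_one (by positivity)]; linarith
      · rw [div_le_one (by positivity)]; linarith
    have h3 : (I.card : ℝ) * (1 / (2 * (Fintype.card W : ℝ))) / 2 =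
        I.card / (4 * Fintype.card W) := by ring
    linarith
  have hsum : ((Fintype.card W : ℝ) - I.card) * (I.card / (4 * Fintype.card W)) ≤
      ∑ y ∈ Iᶜ, 𝔼 coins : PhaseCoins W d ℓ,
        (1 - ∏ u ∈ I, (1 - if walkPos G (coins (b, u)) u ℓ = y then (1 : ℝ) else 0)) := by
    refine le_trans (le_of_eq ?_) (Finset.card_nsmul_le_sum Iᶜ _ _ fun y _ => hy y)
    rw [nsmul_eq_mul, Finset.card_compl, Nat.cast_sub (Finset.card_le_univ I)]
  have h5 := mul_le_mul_of_nonneg_left hsum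
    (show 0 ≤ (Fintype.card W : ℝ) / (2 * (I.card : ℝ) ^ 2) by positivity)
  have h6 : (Fintype.card W : ℝ) / (2 * (I.card : ℝ) ^ 2) *
      (((Fintype.card W : ℝ) - I.card) * (I.card / (4 * Fintype.card W))) =
      1 / 8 * spreadPot I := by
    rw [spreadPot]; field_simp; ring
  linarith

/-- The potential never increases, so rare congestion costs little. -/
lemma expect_spreadPot_le {L : ℕ} (h : GoodPhase G d ℓ L) (b : Bool) {I : Finset W}
    (hI : I.Nonempty) :
    𝔼 coins : PhaseCoins W d ℓ,
      spreadPot (spreadStep (fun u => destination G coins (ℓ * (L * d)) (b, u)) I) ≤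
      15 / 16 * spreadPot I := by
  have hne : Nonempty W := hI.to_type
  have hm : (1 : ℝ) ≤ Fintype.card W := by exact_mod_cast Fintype.card_pos
  have h1 := expect_le_add_frac_mul (p := Congested (d := d) (ℓ := ℓ) G L)
    (F := fun coins => spreadPot
      (spreadStep (fun u => destination G coins (ℓ * (L * d)) (b, u)) I))
    (F' := fun coins => spreadPot (spreadStep (fun u => walkPos G (coins (b, u)) u ℓ) I))
    (fun _ => spreadPot_nonneg (hI.mono Finset.subset_union_left))
    (fun coins hc => by simp only [destination_of_not_congested h hc])
    (fun _ => spreadPot_anti hI Finset.subset_union_left)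
  have h2 := expect_spreadPot_walkPos_le h b hI
  have h3 : frac (Congested (d := d) (ℓ := ℓ) G L) ≤ 1 / 16 :=
    h.rare.trans (one_div_le_one_div_of_le (by norm_num) (by linarith))
  have h4 := mul_le_mul_of_nonneg_right h3 (spreadPot_nonneg hI)
  linarith

end Spread

/-! ### Push-sum for fixed destinations -/

section SpreadSet

variable {W : Type*} [DecidableEq W]

/-- The nodes reached from `x` in `j` phases that start with phase `T`. -/
def spreadSet (dest : ℕ → W → W) (T : ℕ) (x : W) : ℕ → Finset W
  | 0 => {x}
  | j + 1 => spreadStep (dest (T + j)) (spreadSet dest T x j)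

lemma spreadSet_nonempty (dest : ℕ → W → W) (T : ℕ) (x : W) (j : ℕ) :
    (spreadSet dest T x j).Nonempty := by
  induction j with
  | zero => exact Finset.singleton_nonempty x
  | succ j ih => exact ih.mono Finset.subset_union_left

lemma spreadSet_congr {dest dest' : ℕ → W → W} {T : ℕ} (x : W) {j : ℕ}
    (h : ∀ s < T + j, dest s = dest' s) : spreadSet dest T x j = spreadSet dest' T x j := by
  induction j with
  | zero => rfl
  | succ j ih =>
    rw [spreadSet, spreadSet, ih fun s hs => h s (by omega), h (T + j) (by omega)]

end SpreadSet

section Deterministic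

variable {W : Type*} [Fintype W]

lemma pushSum_succ {M : Type*} [AddCommGroup M] [Module ℝ M] (dest : ℕ → W → W) (init : W → M)
    (t : ℕ) : pushSum dest init (t + 1) = pushStep (dest t) (pushSum dest init t) := rfl

lemma pushSum_congr {M : Type*} [AddCommGroup M] [Module ℝ M] {dest dest' : ℕ → W → W}
    (init : W → M) {t : ℕ} (h : ∀ s < t, dest s = dest' s) :
    pushSum dest init t = pushSum dest' init t := by
  induction t with
  | zero => rfl
  | succ t ih =>
    rw [pushSum_succ, pushSum_succ, ih fun s hs => h s (by omega), h t (by omega)]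

lemma pushSum_apply {κ : Type*} (dest : ℕ → W → W) (init : W → κ → ℝ) (t : ℕ) (v : W) (j : κ) :
    pushSum dest init t v j = pushSum dest (fun u => init u j) t v := by
  induction t generalizing v with
  | zero => rfl
  | succ t ih =>
    simp only [pushSum_succ, pushStep, Pi.add_apply, Pi.smul_apply, Finset.sum_apply, ih]

lemma pushSum_sum_mul {κ : Type*} [Fintype κ] (dest : ℕ → W → W) (a : κ → ℝ) (init : κ → W → ℝ)
    (t : ℕ) (v : W) : pushSum dest (fun u => ∑ k, a k * init k u) t v =
      ∑ k, a k * pushSum dest (init k) t v := by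
  classical
  induction t generalizing v with
  | zero => rfl
  | succ t ih =>
    simp only [pushSum_succ, pushStep, ih, smul_eq_mul, mul_add, Finset.sum_add_distrib,
      Finset.mul_sum]
    rw [Finset.sum_comm]
    congr 1
    · exact Finset.sum_congr rfl fun _ _ => by ring
    · exact Finset.sum_congr rfl fun _ _ => Finset.sum_congr rfl fun _ _ => by ring

lemma sum_pushSum (dest : ℕ → W → W) (init : W → ℝ) (t : ℕ) :
    ∑ v, pushSum dest init t v = ∑ v, init v := by
  classical
  induction t with
  | zero => rfl
  | succ t ih => rw [pushSum_succ, sum_pushStep, ih]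

lemma pushStep_nonneg (D : W → W) {x : W → ℝ} (hx : ∀ v, 0 ≤ x v) (v : W) :
    0 ≤ pushStep D x v := by
  rw [pushStep]
  refine add_nonneg (smul_nonneg (by norm_num) (hx v))
    (Finset.sum_nonneg fun u _ => smul_nonneg (by norm_num) (hx u))

lemma pushSum_nonneg (dest : ℕ → W → W) {init : W → ℝ} (h : ∀ v, 0 ≤ init v) (t : ℕ) (v : W) :
    0 ≤ pushSum dest init t v := by
  induction t generalizing v with
  | zero => exact h v
  | succ t ih => exact pushStep_nonneg _ ih v

lemma half_le_pushStep (D : W → W) {x : W → ℝ} (hx : ∀ v, 0 ≤ x v) (v : W) :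
    x v / 2 ≤ pushStep D x v ∧ x v / 2 ≤ pushStep D x (D v) := by
  classical
  have h : ∀ y u, 0 ≤ if D u = y then x u else 0 := fun y u => by
    split_ifs
    exacts [hx u, le_rfl]
  rw [pushStep_real, pushStep_real]
  refine ⟨?_, ?_⟩
  · linarith [Finset.sum_nonneg fun u (_ : u ∈ Finset.univ) => h v u]
  · have := Finset.single_le_sum (fun u _ => h (D v) u) (Finset.mem_univ v)
    rw [if_pos rfl] at this
    linarith [hx (D v)]

lemma sum_initWeight [Nonempty W] {ID : W → ℕ} (hID : Function.Injective ID) :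
    ∑ u, initWeight ID u = 1 := by
  obtain ⟨z, -, hz⟩ := Finset.exists_min_image Finset.univ ID Finset.univ_nonempty
  rw [Finset.sum_eq_single z]
  · simp only [initWeight]
    rw [if_pos fun v => hz v (Finset.mem_univ v)]
  · intro u _ hu
    simp only [initWeight]
    rw [if_neg fun h => hu (hID (le_antisymm (h z) (hz u (Finset.mem_univ u))))]
  · simp

lemma initWeight_nonneg (ID : W → ℕ) (u : W) : 0 ≤ initWeight ID u := by
  rw [initWeight]; split_ifs <;> norm_num

variable [DecidableEq W]

/-- A node reached from `x` in `j` phases gets a share of at least `2 ^ (-j)`. -/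
lemma le_pushSum_of_mem_spreadSet (dest : ℕ → W → W) {init : W → ℝ} (h : ∀ v, 0 ≤ init v) (T : ℕ)
    (x : W) (j : ℕ) {y : W} (hy : y ∈ spreadSet dest T x j) :
    pushSum dest init T x / 2 ^ j ≤ pushSum dest init (T + j) y := by
  induction j generalizing y with
  | zero =>
    rw [spreadSet, Finset.mem_singleton] at hy
    simp [hy]
  | succ j ih =>
    rw [← add_assoc, pushSum_succ, pow_succ, ← div_div]
    have hhalf := half_le_pushStep (dest (T + j)) (pushSum_nonneg dest h (T + j))
    rw [spreadSet, spreadStep, Finset.mem_union, Finset.mem_image] at hy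
    rcases hy with hy | ⟨u, hu, rfl⟩
    · exact (div_le_div_of_nonneg_right (ih hy) (by norm_num)).trans (hhalf y).1
    · exact (div_le_div_of_nonneg_right (ih hu) (by norm_num)).trans (hhalf u).2

/-- The initial values whose push-sum is the error caused by the unit mass of the node `w`: this
mass minus the weights. -/
noncomputable def errInit (ID : W → ℕ) (w : W) : W → ℝ := Pi.single w 1 - initWeight ID

lemma sum_errInit [Nonempty W] {ID : W → ℕ} (hID : Function.Injective ID) (w : W) :
    ∑ u, errInit ID w u = 0 := by
  simp [errInit, sum_initWeight hID, Pi.single_apply]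

lemma sum_errInit_sq_le [Nonempty W] {ID : W → ℕ} (hID : Function.Injective ID) (w : W) :
    ∑ u, errInit ID w u ^ 2 ≤ 2 := by
  calc ∑ u, errInit ID w u ^ 2 ≤ ∑ u, ((Pi.single w 1 : W → ℝ) u + initWeight ID u) := by
        refine Finset.sum_le_sum fun u _ => ?_
        simp only [errInit, Pi.sub_apply, Pi.single_apply, initWeight]
        split_ifs <;> norm_num
    _ = 2 := by
        rw [Finset.sum_add_distrib, sum_initWeight hID]
        simp [Pi.single_apply]
        norm_num

/-- The error of the ratio estimate, in multiples of the weight, is a combination of the push-sums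
of mean zero that start from `errInit`. -/
lemma pushSum_sub_mul (dest : ℕ → W → W) (ID : W → ℕ) (a : W → ℝ) (t : ℕ) (v : W) :
    pushSum dest a t v - (∑ w, a w) * pushSum dest (initWeight ID) t v =
      ∑ w, a w * pushSum dest (errInit ID w) t v := by
  rw [← pushSum_sum_mul]
  have h := pushSum_sum_mul dest ![1, -∑ w, a w] ![a, initWeight ID] t v
  simp only [Fin.sum_univ_two, Matrix.cons_val_zero, Matrix.cons_val_one, one_mul] at h
  have h2 : (fun u => ∑ w, a w * errInit ID w u) =
      fun u => a u + (-∑ w, a w) * initWeight ID u := by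
    ext u
    simp [errInit, mul_sub, Finset.sum_sub_distrib, Finset.sum_mul, Pi.single_apply,
      ← sub_eq_add_neg]
  rw [h2, h]
  ring

end Deterministic

/-! ### Rounding -/

/-- In a set of legal values at mutual distance at least `c`, a legal value closer than `c / 2` is
the only nearest one. -/
lemma roundTo_eq {R : Set ℝ} {c : ℝ} (hR : ∀ a ∈ R, ∀ b ∈ R, a ≠ b → c ≤ |a - b|) {a y : ℝ}
    (ha : a ∈ R) (hy : |y - a| < c / 2) : roundTo R y = a := by
  have hnear : ∀ r ∈ R, r ≠ a → |y - a| < |y - r| := fun r hr hne => by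
    have h1 := hR r hr a ha hne
    have h2 : |r - a| ≤ |y - a| + |y - r| := by
      have := abs_sub_le r y a
      rw [abs_sub_comm r y] at this
      linarith
    linarith
  have hex : ∃ r ∈ R, ∀ r' ∈ R, |y - r| ≤ |y - r'| := by
    refine ⟨a, ha, fun r hr => ?_⟩
    by_cases h : r = a
    · rw [h]
    · exact (hnear r hr h).le
  rw [roundTo, dif_pos hex]
  by_contra hne
  have hspec := Classical.choose_spec hex
  exact absurd (hspec.2 a ha) (not_le.2 (hnear _ hspec.1 hne))

lemma part_add_part {κ : Type*} (y : κ → ℝ) (j : κ) : part true y j + part false y j = y j := by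
  simp [part, max_add_min]

lemma abs_part_le {κ : Type*} (b : Bool) (y : κ → ℝ) (j : κ) : |part b y j| ≤ |y j| := by
  rcases le_total (y j) 0 with h | h <;> cases b <;> simp [part, h]

/-! ### A run of the primitive -/

section Run

variable {W : Type*} [Fintype W] {d ℓ Ts : ℕ} {G : SimpleGraph W}

lemma target_update_of_lt (Tp : ℕ) (ω : RunCoins W d ℓ Ts) (b : Bool) {t : ℕ} (ht : t < Ts)
    (c : PhaseCoins W d ℓ) {s : ℕ} (hs : s < t) :
    target G Tp (Function.update ω ⟨t, ht⟩ c) b s = target G Tp ω b s := by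
  funext u
  rw [target, target, dif_pos (hs.trans ht), dif_pos (hs.trans ht), Function.update_of_ne]
  exact Fin.ne_of_lt hs

lemma target_update_self (Tp : ℕ) (ω : RunCoins W d ℓ Ts) (b : Bool) {t : ℕ} (ht : t < Ts)
    (c : PhaseCoins W d ℓ) :
    target G Tp (Function.update ω ⟨t, ht⟩ c) b t = fun u => destination G c Tp (b, u) := by
  funext u
  rw [target, dif_pos ht, Function.update_self]

variable [DecidableEq W] [Nonempty W] {L : ℕ}

/-- Mass that is at `x` after `T` phases rarely fails to reach all nodes in the next `τ` phases. -/
lemma frac_spread_le (h : GoodPhase G d ℓ L) (b : Bool) (T τ : ℕ) (hT : T + τ ≤ Ts) (x : W) :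
    frac (fun ω : RunCoins W d ℓ Ts =>
      spreadSet (target G (ℓ * (L * d)) ω b) T x τ ≠ Finset.univ) ≤
      Fintype.card W ^ 2 * (15 / 16) ^ τ := by
  have : NeZero (2 * d) := ⟨by have := h.one_le; omega⟩
  have hm : (0 : ℝ) < Fintype.card W := by exact_mod_cast Fintype.card_pos
  let V : ℕ → RunCoins W d ℓ Ts → ℝ := fun t ω =>
    spreadPot (spreadSet (target G (ℓ * (L * d)) ω b) T x (t - T))
  have hV := expect_le_pow_mul V (ρ := 15 / 16) (by norm_num) T (fun t ht ω hTt => by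
    have hsub : t + 1 - T = t - T + 1 := by omega
    have hstep : ∀ c, V (t + 1) (Function.update ω ⟨t, ht⟩ c) =
        spreadPot (spreadStep (fun u => destination G c (ℓ * (L * d)) (b, u))
          (spreadSet (target G (ℓ * (L * d)) ω b) T x (t - T))) := fun c => by
      simp only [V, hsub, spreadSet]
      rw [show T + (t - T) = t by omega, target_update_self]
      congr 2
      exact spreadSet_congr x fun s hs => target_update_of_lt _ ω b ht c (by omega)
    simp only [hstep]
    exact expect_spreadPot_le h b (spreadSet_nonempty _ T x _)) τ hT
  have hV0 : 𝔼 ω, V T ω ≤ Fintype.card W := by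
    simp [V, spreadSet, spreadPot]
  have h1 := frac_le_div (F := V (T + τ)) (a := 1 / Fintype.card W)
    (p := fun ω : RunCoins W d ℓ Ts =>
      spreadSet (target G (ℓ * (L * d)) ω b) T x τ ≠ Finset.univ) (by positivity)
    (fun ω => spreadPot_nonneg (spreadSet_nonempty _ T x _)) (fun ω hω => by
      simp only [V, Nat.add_sub_cancel_left]
      exact le_spreadPot (spreadSet_nonempty _ T x _) hω)
  refine h1.trans ?_
  rw [div_div_eq_mul_div, div_one]
  calc (𝔼 ω, V (T + τ) ω) * (Fintype.card W : ℝ)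
      ≤ ((15 / 16) ^ τ * Fintype.card W) * Fintype.card W := by
        gcongr
        exact hV.trans (by gcongr)
    _ = _ := by ring

/-- The sum of the squared errors caused by the unit masses of all nodes, after `t` phases. Bounding
it once serves all entries of the sketch vectors, whose number is unbounded. -/
noncomputable def errPot (G : SimpleGraph W) (ID : W → ℕ) (Tp : ℕ) (b : Bool) (t : ℕ)
    (ω : RunCoins W d ℓ Ts) : ℝ :=
  ∑ w, ∑ u, pushSum (target G Tp ω b) (errInit ID w) t u ^ 2

lemma errPot_nonneg {W : Type*} [Fintype W] [DecidableEq W] {d ℓ Ts : ℕ} (G : SimpleGraph W)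
    (ID : W → ℕ) (Tp : ℕ) (b : Bool) (t : ℕ) (ω : RunCoins W d ℓ Ts) :
    0 ≤ errPot G ID Tp b t ω :=
  Finset.sum_nonneg fun _ _ => Finset.sum_nonneg fun _ _ => sq_nonneg _

lemma frac_errPot_le (h : GoodPhase G d ℓ L) {ID : W → ℕ} (hID : Function.Injective ID) (b : Bool)
    {a : ℝ} (ha : 0 < a) :
    frac (fun ω : RunCoins W d ℓ Ts => a ≤ errPot G ID (ℓ * (L * d)) b Ts ω) ≤
      2 * Fintype.card W * (3 / 4) ^ Ts / a := by
  have : NeZero (2 * d) := ⟨by have := h.one_le; omega⟩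
  refine (frac_le_div ha (fun ω => errPot_nonneg G ID (ℓ * (L * d)) b Ts ω)
    fun _ hω => hω).trans ?_
  have hV := expect_le_pow_mul (fun t ω => errPot (d := d) (ℓ := ℓ) (Ts := Ts) G ID
    (ℓ * (L * d)) b t ω) (ρ := 3 / 4) (by norm_num) 0 (fun t ht ω _ => by
      have hstep : ∀ c, errPot G ID (ℓ * (L * d)) b (t + 1) (Function.update ω ⟨t, ht⟩ c) =
          ∑ w, ∑ u, pushStep (fun u => destination G c (ℓ * (L * d)) (b, u))
            (pushSum (target G (ℓ * (L * d)) ω b) (errInit ID w) t) u ^ 2 := fun c => by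
        simp only [errPot, pushSum_succ]
        rw [target_update_self]
        simp only [pushSum_congr _ fun s hs =>
          target_update_of_lt (G := G) (ℓ * (L * d)) ω b ht c hs]
      simp only [hstep]
      rw [Finset.expect_sum_comm, errPot, Finset.mul_sum]
      refine Finset.sum_le_sum fun w _ => expect_sum_pushStep_le h b ?_
      rw [sum_pushSum, sum_errInit hID]) Ts (by omega)
  have hV0 : 𝔼 ω, errPot (d := d) (ℓ := ℓ) (Ts := Ts) G ID (ℓ * (L * d)) b 0 ω ≤
      2 * Fintype.card W := by
    refine Finset.expect_le Finset.univ_nonempty fun ω _ => ?_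
    refine (Finset.sum_le_sum fun w _ => sum_errInit_sq_le hID w).trans ?_
    simp [mul_comm]
  rw [zero_add] at hV
  gcongr
  refine hV.trans ?_
  rw [mul_comm]
  gcongr

/-- If the weights are not too small and the errors are small compared to them, rounding gives the
exact aggregate. -/
lemma allCorrect_of_lt {κ : Type*} {ID : W → ℕ} (hID : Function.Injective ID) {R : Set ℝ} {c : ℝ}
    (hc : 0 < c) (hR : ∀ a ∈ R, ∀ b ∈ R, a ≠ b → c ≤ |a - b|) {s : W → κ → ℝ} {x : ℝ} (hx : 0 < x)
    (hs : ∀ u j, |s u j| ≤ x) (hagg : ∀ b, ∀ j, (∑ u, part b (s u)) j ∈ R) {T τ Tp : ℕ} {δ : ℝ}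
    (hδ0 : 0 ≤ δ) (hδ : Fintype.card W * (x * δ) ≤ c / 2 * (1 / Fintype.card W / 2 ^ τ))
    {ω : RunCoins W d ℓ (T + τ)}
    (hspread : ∀ b, ∀ z, spreadSet (target G Tp ω b) T z τ = Finset.univ)
    (herr : ∀ b, errPot G ID Tp b (T + τ) ω < δ ^ 2) : AllCorrect G ID R Tp s ω := by
  have hm : (0 : ℝ) < Fintype.card W := by exact_mod_cast Fintype.card_pos
  have hw : ∀ b u, 1 / Fintype.card W / 2 ^ τ ≤ weight G ID Tp ω b (T + τ) u := by
    intro b u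
    -- after `T` phases some node has at least the average weight
    obtain ⟨z, -, hz⟩ : ∃ z ∈ Finset.univ, 1 / (Fintype.card W : ℝ) ≤
        pushSum (target G Tp ω b) (initWeight ID) T z := by
      refine Finset.exists_le_of_sum_le Finset.univ_nonempty ?_
      rw [sum_pushSum, sum_initWeight hID]
      simp
    refine le_trans ?_ (le_pushSum_of_mem_spreadSet _ (initWeight_nonneg ID) T z τ
      (by rw [hspread b z]; exact Finset.mem_univ u))
    gcongr
  have hpos : ∀ b u, 0 < weight G ID Tp ω b (T + τ) u := fun b u =>
    lt_of_lt_of_le (by positivity) (hw b u)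
  have hround : ∀ b u j, roundTo R (vector G Tp s ω b (T + τ) u j /
      weight G ID Tp ω b (T + τ) u) = ∑ v, part b (s v) j := by
    intro b u j
    refine roundTo_eq hR (by simpa using hagg b j) ?_
    have h1 : vector G Tp s ω b (T + τ) u j - (∑ v, part b (s v) j) *
        weight G ID Tp ω b (T + τ) u =
        ∑ w, part b (s w) j * pushSum (target G Tp ω b) (errInit ID w) (T + τ) u := by
      rw [vector, pushSum_apply, weight, pushSum_sub_mul]
    have h2 : ∀ w, |part b (s w) j * pushSum (target G Tp ω b) (errInit ID w) (T + τ) u| <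
        x * δ := fun w => by
      have h3 : pushSum (target G Tp ω b) (errInit ID w) (T + τ) u ^ 2 < δ ^ 2 := by
        refine lt_of_le_of_lt ?_ (herr b)
        refine (Finset.single_le_sum (f := fun u =>
          pushSum (target G Tp ω b) (errInit ID w) (T + τ) u ^ 2)
          (fun _ _ => sq_nonneg _) (Finset.mem_univ u)).trans ?_
        exact Finset.single_le_sum (f := fun w => ∑ u,
          pushSum (target G Tp ω b) (errInit ID w) (T + τ) u ^ 2)
          (fun _ _ => Finset.sum_nonneg fun _ _ => sq_nonneg _) (Finset.mem_univ w)
      rw [abs_mul]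
      calc _ ≤ x * |pushSum (target G Tp ω b) (errInit ID w) (T + τ) u| := by
            gcongr
            exact (abs_part_le b (s w) j).trans (hs w j)
        _ < x * δ := by
            gcongr
            exact abs_lt_of_sq_lt_sq h3 hδ0
    have h4 : |vector G Tp s ω b (T + τ) u j - (∑ v, part b (s v) j) *
        weight G ID Tp ω b (T + τ) u| < c / 2 * weight G ID Tp ω b (T + τ) u := by
      rw [h1]
      calc _ ≤ ∑ w, |part b (s w) j * pushSum (target G Tp ω b) (errInit ID w) (T + τ) u| :=
            Finset.abs_sum_le_sum_abs _ _
        _ < ∑ _w : W, x * δ :=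
            Finset.sum_lt_sum_of_nonempty Finset.univ_nonempty fun w _ => h2 w
        _ = Fintype.card W * (x * δ) := by simp
        _ ≤ c / 2 * (1 / Fintype.card W / 2 ^ τ) := hδ
        _ ≤ _ := mul_le_mul_of_nonneg_left (hw b u) (by positivity)
    have h6 : vector G Tp s ω b (T + τ) u j / weight G ID Tp ω b (T + τ) u -
        ∑ v, part b (s v) j = (vector G Tp s ω b (T + τ) u j - (∑ v, part b (s v) j) *
        weight G ID Tp ω b (T + τ) u) / weight G ID Tp ω b (T + τ) u := by
      rw [sub_div, mul_div_cancel_right₀ _ (hpos b u).ne']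
    rw [h6, abs_div, abs_of_pos (hpos b u), div_lt_iff₀ (hpos b u)]
    exact h4
  refine fun u => ⟨fun b => hpos b u, ?_⟩
  funext j
  rw [output, hround, hround, ← Finset.sum_add_distrib, Finset.sum_apply]
  exact Finset.sum_congr rfl fun v _ => part_add_part _ _

lemma one_sub_le_successProb {κ : Type*} (h : GoodPhase G d ℓ L) {ID : W → ℕ}
    (hID : Function.Injective ID) {R : Set ℝ} {c : ℝ}
    (hc : 0 < c) (hR : ∀ a ∈ R, ∀ b ∈ R, a ≠ b → c ≤ |a - b|) {s : W → κ → ℝ} {x : ℝ} (hx : 0 < x)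
    (hs : ∀ u j, |s u j| ≤ x) (hagg : ∀ b, ∀ j, (∑ u, part b (s u)) j ∈ R) {T τ : ℕ} {δ : ℝ}
    (hδ0 : 0 < δ) (hδ : Fintype.card W * (x * δ) ≤ c / 2 * (1 / Fintype.card W / 2 ^ τ)) :
    1 - 2 * (Fintype.card W ^ 3 * (15 / 16) ^ τ +
      2 * Fintype.card W * (3 / 4) ^ (T + τ) / δ ^ 2) ≤
      successProb G ID R d ℓ (ℓ * (L * d)) (T + τ) s := by
  have : NeZero (2 * d) := ⟨by have := h.one_le; omega⟩
  rw [successProb, uniformOn_real_eq_frac]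
  set ok : RunCoins W d ℓ (T + τ) → Prop := fun ω => AllCorrect G ID R (ℓ * (L * d)) s ω
  let bad : Bool → RunCoins W d ℓ (T + τ) → Prop := fun b ω =>
    (∃ z, spreadSet (target G (ℓ * (L * d)) ω b) T z τ ≠ Finset.univ) ∨
      δ ^ 2 ≤ errPot G ID (ℓ * (L * d)) b (T + τ) ω
  have hbad : ∀ b, frac (bad b) ≤ Fintype.card W ^ 3 * (15 / 16) ^ τ +
      2 * Fintype.card W * (3 / 4) ^ (T + τ) / δ ^ 2 := by
    intro b
    refine (frac_or_le _ _).trans (add_le_add ?_ (frac_errPot_le h hID b (by positivity)))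
    refine (frac_exists_le _).trans ?_
    refine (Finset.sum_le_sum fun z _ => frac_spread_le h b T τ le_rfl z).trans ?_
    simp only [Finset.sum_const, Finset.card_univ, nsmul_eq_mul]
    apply le_of_eq
    ring
  have hfail : frac (fun ω => ¬ ok ω) ≤ ∑ b, frac (bad b) := by
    refine le_trans (frac_mono fun ω hω => ?_) (frac_exists_le bad)
    by_contra hcon
    push Not at hcon
    refine hω (allCorrect_of_lt hID hc hR hx hs hagg hδ0.le hδ (fun b z => ?_) fun b => ?_)
    · by_contra hne
      exact hcon b (Or.inl ⟨z, hne⟩)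
    · exact lt_of_not_ge fun hle => hcon b (Or.inr hle)
  rw [Fintype.sum_bool] at hfail
  rw [frac_not] at hfail
  linarith [hbad true, hbad false]

end Run

/-! ### Parameters -/

section Parameters

/-- The lower bound on the spectral gap guaranteed by conductance `φ` and degree `d`. -/
noncomputable def gap (d : ℕ) (φ : ℝ) : ℝ := φ ^ 2 / (16 * d ^ 2)

/-- The length of the walks. The squared deviation from uniform is then at most `n ^ (-4)`. -/
noncomputable def walkLen (d : ℕ) (φ : ℝ) (n : ℕ) : ℕ := ⌈4 / gap d φ * Real.log n⌉₊

/-- The number of walks for which the schedule of a phase has room at each node and step. Congestion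
beyond it has probability at most `1 / (16 * n)`, since `2 ^ load n` is at least `n ^ 5`. -/
noncomputable def load (n : ℕ) : ℕ := ⌈10 * Real.log n⌉₊

/-- The number of rounds of a phase. -/
noncomputable def phaseLen (d : ℕ) (φ : ℝ) (n : ℕ) : ℕ := walkLen d φ n * (load n * d)

/-- The number of final phases, in which the weight spreads to all nodes. -/
noncomputable def spreadLen (γ : ℝ) (n : ℕ) : ℕ := ⌈16 * (4 + γ) * Real.log n⌉₊

/-- The number of phases before the last `spreadLen γ n` ones. -/
noncomputable def mixLen (γ : ℝ) (n : ℕ) (x : ℝ) : ℕ :=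
  ⌈4 * (135 + 33 * γ) * Real.log n + 8 * Real.log (n * x)⌉₊

lemma gap_pos {d : ℕ} {φ : ℝ} (hd : 1 ≤ d) (hφ : 0 < φ) : 0 < gap d φ := by
  have : (0 : ℝ) < d := by exact_mod_cast hd
  rw [gap]; positivity

lemma one_le_log {n : ℕ} (hn : 3 ≤ n) : 1 ≤ Real.log n := by
  have h : (3 : ℝ) ≤ n := by exact_mod_cast hn
  rw [Real.le_log_iff_exp_le (by linarith)]
  exact Real.exp_one_lt_three.le.trans h

lemma natCeil_le_of_one_le {a y : ℝ} (ha : 0 ≤ a) (hy : 1 ≤ y) : (⌈a * y⌉₊ : ℝ) ≤ (a + 1) * y := by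
  have := (Nat.ceil_lt_add_one (show 0 ≤ a * y by positivity)).le
  linarith

lemma pow_le_exp_neg_mul {a b : ℝ} (ha : 0 ≤ a) (hab : a = 1 - b) (k : ℕ) :
    a ^ k ≤ Real.exp (-(k * b)) := by
  rw [show -(k * b) = k * (-b) by ring, Real.exp_nat_mul]
  gcongr
  rw [hab]
  linarith [Real.add_one_le_exp (-b)]

lemma half_le_log_two : 1 / 2 ≤ Real.log 2 := by linarith [Real.log_two_gt_d9]

/-- With these parameters, phases on an expander are good. -/
lemma goodPhase_of_isExpander {W : Type*} [Fintype W] [DecidableEq W] {G : SimpleGraph W} {d n : ℕ}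
    {φ : ℝ} (hd : 1 ≤ d) (hφ : 0 < φ) (hn : 128 ≤ n) (hn' : 4 / gap d φ + 1 ≤ n)
    (hG : IsExpander φ G) (hdeg : ∀ u, deg G u ≤ d) (hW : Fintype.card W ≤ n) :
    GoodPhase G d (walkLen d φ n) (load n) := by
  have hne : Nonempty W := hG.1.nonempty
  have hm : (1 : ℝ) ≤ Fintype.card W := by exact_mod_cast Fintype.card_pos
  have hmn : (Fintype.card W : ℝ) ≤ n := by exact_mod_cast hW
  have hn0 : (128 : ℝ) ≤ n := by exact_mod_cast hn
  have hnpos : (0 : ℝ) < n := by linarith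
  have hβ := gap_pos hd hφ
  have hlog := one_le_log (show 3 ≤ n by omega)
  have hκ : 1 - φ ^ 2 / (16 * d ^ 2) ≤ Real.exp (-gap d φ) := by
    linarith [Real.add_one_le_exp (-gap d φ), gap.eq_1 d φ]
  have hpow : Real.exp (-gap d φ) ^ walkLen d φ n ≤ 1 / (n : ℝ) ^ 4 := by
    have h1 : 4 / gap d φ * Real.log n ≤ walkLen d φ n := Nat.le_ceil _
    have h2 : 4 * Real.log n ≤ walkLen d φ n * gap d φ := by
      calc 4 * Real.log n = 4 / gap d φ * Real.log n * gap d φ := by field_simp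
        _ ≤ _ := by gcongr
    rw [← Real.exp_nat_mul, one_div, ← Real.exp_log (pow_pos hnpos 4), ← Real.exp_neg, Real.log_pow]
    gcongr
    push_cast
    linarith
  refine ⟨hd, hdeg, fun x hx => ?_, fun u v => ?_, ?_⟩
  · refine (sum_lazyStep_pow_sq_le hφ hG hd hdeg (Real.exp_pos _).le hκ _ hx).trans ?_
    refine mul_le_mul_of_nonneg_right ?_ (Finset.sum_nonneg fun _ _ => sq_nonneg _)
    refine hpow.trans (one_div_le_one_div_of_le (by norm_num) ?_)
    calc (16 : ℝ) ≤ 128 ^ 4 := by norm_num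
      _ ≤ (n : ℝ) ^ 4 := by gcongr
  · refine le_walkProb hφ hG hd hdeg (Real.exp_pos _).le hκ (hpow.trans ?_) u v
    rw [div_pow, one_pow]
    refine one_div_le_one_div_of_le (by positivity) ?_
    calc (2 * (Fintype.card W : ℝ)) ^ 2 ≤ (2 * (n : ℝ)) ^ 2 := by gcongr
      _ = 4 * (n : ℝ) ^ 2 := by ring
      _ ≤ (n : ℝ) ^ 2 * (n : ℝ) ^ 2 := by gcongr; nlinarith
      _ = (n : ℝ) ^ 4 := by ring
  · refine (frac_congested_le hd hdeg _).trans ?_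
    have h1 : (walkLen d φ n : ℝ) ≤ n ^ 2 := by
      have h2 := natCeil_le_of_one_le (show 0 ≤ 4 / gap d φ by positivity) hlog
      have h3 : Real.log n ≤ n := by linarith [Real.log_le_sub_one_of_pos hnpos]
      calc (walkLen d φ n : ℝ) ≤ (4 / gap d φ + 1) * Real.log n := h2
        _ ≤ n * n := by gcongr
        _ = n ^ 2 := by ring
    have h2 : (n : ℝ) ^ 5 ≤ 2 ^ load n := by
      have h3 : 10 * Real.log n ≤ load n := Nat.le_ceil _
      rw [← Real.log_le_log_iff (by positivity) (by positivity), Real.log_pow, Real.log_pow]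
      push_cast
      have h4 := mul_le_mul_of_nonneg_left half_le_log_two (Nat.cast_nonneg (α := ℝ) (load n))
      linarith
    have h3 : Real.exp 2 ≤ 8 := by
      have h4 : Real.exp 2 = Real.exp 1 ^ 2 := by rw [← Real.exp_nat_mul]; norm_num
      have h5 := Real.exp_one_lt_d9
      rw [h4]
      nlinarith [Real.exp_pos 1]
    rw [mul_div_assoc', div_le_div_iff₀ (by positivity) (by positivity), one_mul]
    calc (walkLen d φ n : ℝ) * Fintype.card W * Real.exp 2 * (16 * Fintype.card W)
        ≤ n ^ 2 * n * 8 * (16 * n) := by gcongr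
      _ = 128 * n ^ 4 := by ring
      _ ≤ n * n ^ 4 := by gcongr
      _ = n ^ 5 := by ring
      _ ≤ _ := h2

/-- With these numbers of phases, the failure probability is small enough. -/
lemma failure_le {γ c x m : ℝ} {n : ℕ} (hγ : 0 < γ) (hc : 0 < c) (hn : 32 ≤ n)
    (hnc : 1 / c ^ 2 ≤ n) (hx : c ≤ x) (hm0 : 0 ≤ m) (hm : m ≤ n) :
    2 * (m ^ 3 * (15 / 16) ^ spreadLen γ n +
      2 * m * (3 / 4) ^ (mixLen γ n x + spreadLen γ n) /
        (c / (2 * n ^ 2 * x * 2 ^ spreadLen γ n)) ^ 2) ≤ (n : ℝ) ^ (-γ) := by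
  have hn0 : (32 : ℝ) ≤ n := by exact_mod_cast hn
  have hnpos : (0 : ℝ) < n := by linarith
  have hxpos : 0 < x := hc.trans_le hx
  have hlog := one_le_log (show 3 ≤ n by omega)
  set lam := Real.log n with hlam
  set Lam := Real.log (n * x) with hLam
  set τ := spreadLen γ n with hτ
  have hnexp : (n : ℝ) = Real.exp lam := (Real.exp_log hnpos).symm
  have hτ1 : 16 * (4 + γ) * lam ≤ τ := Nat.le_ceil _
  have hτ2 : (τ : ℝ) ≤ (16 * (4 + γ) + 1) * lam := natCeil_le_of_one_le (by positivity) hlog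
  have hT : 4 * (135 + 33 * γ) * lam + 8 * Lam ≤ mixLen γ n x := Nat.le_ceil _
  have htarget : (n : ℝ) ^ (-γ) = Real.exp (-(γ * lam)) := by
    rw [Real.rpow_def_of_pos hnpos]; congr 1; ring
  have hinv : Real.exp (-lam) ≤ 1 / 32 := by
    rw [Real.exp_neg, ← hnexp, ← one_div]
    exact one_div_le_one_div_of_le (by norm_num) hn0
  have h1 : m ^ 3 * (15 / 16) ^ τ ≤ 1 / 32 * Real.exp (-(γ * lam)) := by
    calc m ^ 3 * (15 / 16) ^ τ ≤ (n : ℝ) ^ 3 * Real.exp (-(τ * (1 / 16))) := by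
          gcongr
          exact pow_le_exp_neg_mul (by norm_num) (by norm_num) _
      _ = Real.exp (3 * lam - τ / 16) := by
          rw [hnexp, ← Real.exp_nat_mul, ← Real.exp_add]; congr 1; push_cast; ring
      _ ≤ Real.exp (-lam + -(γ * lam)) := by gcongr; linarith
      _ = Real.exp (-lam) * Real.exp (-(γ * lam)) := Real.exp_add _ _
      _ ≤ _ := by gcongr
  have h4τ : ((2 : ℝ) ^ τ) ^ 2 ≤ Real.exp (2 * τ) := by
    have : (2 : ℝ) ≤ Real.exp 1 := by linarith [Real.add_one_le_exp (1 : ℝ)]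
    calc ((2 : ℝ) ^ τ) ^ 2 ≤ (Real.exp 1 ^ τ) ^ 2 := by gcongr
      _ = Real.exp (2 * τ) := by
        rw [← Real.exp_nat_mul, ← Real.exp_nat_mul]; congr 1; push_cast; ring
  have hnx : (n * x) ^ 2 = Real.exp (2 * Lam) := by
    rw [hLam, ← Real.exp_log (show 0 < (n * x) by positivity), ← Real.exp_nat_mul, Real.log_exp]
    norm_num
  have h2 : 2 * m * (3 / 4) ^ (mixLen γ n x + τ) / (c / (2 * n ^ 2 * x * 2 ^ τ)) ^ 2 ≤
      1 / 4 * Real.exp (-(γ * lam)) := by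
    have e1 : 2 * m * (3 / 4) ^ (mixLen γ n x + τ) / (c / (2 * n ^ 2 * x * 2 ^ τ)) ^ 2 =
        8 * (m * n ^ 2) * (n * x) ^ 2 * (2 ^ τ) ^ 2 * (1 / c ^ 2) *
          (3 / 4) ^ (mixLen γ n x + τ) := by
      field_simp
      ring
    have e2 : ((3 : ℝ) / 4) ^ (mixLen γ n x + τ) ≤ Real.exp (-(mixLen γ n x * (1 / 4))) := by
      refine (pow_le_pow_of_le_one (by norm_num) (by norm_num) (Nat.le_add_right _ τ)).trans ?_
      exact pow_le_exp_neg_mul (by norm_num) (by norm_num) _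
    rw [e1]
    calc _ ≤ 8 * ((n : ℝ) * n ^ 2) * Real.exp (2 * Lam) * Real.exp (2 * τ) * n *
          Real.exp (-(mixLen γ n x * (1 / 4))) := by
          rw [← hnx]; gcongr
      _ = 8 * Real.exp (4 * lam + 2 * Lam + 2 * τ - mixLen γ n x / 4) := by
          have : (n : ℝ) * n ^ 2 * n = Real.exp (4 * lam) := by
            rw [hnexp, show (4 : ℝ) * lam = (4 : ℕ) * lam by norm_num,
              Real.exp_nat_mul]
            ring
          rw [sub_eq_add_neg, Real.exp_add, Real.exp_add, Real.exp_add, ← this]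
          ring_nf
      _ ≤ 8 * Real.exp (-lam + -(γ * lam)) := by gcongr; nlinarith
      _ = 8 * Real.exp (-lam) * Real.exp (-(γ * lam)) := by rw [Real.exp_add]; ring
      _ ≤ 8 * (1 / 32) * Real.exp (-(γ * lam)) := by gcongr
      _ = _ := by ring
  rw [htarget]
  have := Real.exp_pos (-(γ * lam))
  linarith

/-- For `n` large in terms of `c`, the logarithm of `n * x` is positive and dominates that of `n`,
even for `x < 1`. -/
lemma log_le_two_mul_log {c x : ℝ} {n : ℕ} (hc : 0 < c) (hn : 1 ≤ n) (hnc : 1 / c ^ 2 ≤ n)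
    (hx : c ≤ x) : Real.log n ≤ 2 * Real.log (n * x) := by
  have hn0 : (1 : ℝ) ≤ n := by exact_mod_cast hn
  have hnpos : (0 : ℝ) < n := by linarith
  have hxpos := hc.trans_le hx
  rw [show 2 * Real.log (n * x) = Real.log ((n * x) ^ 2) by rw [Real.log_pow]; norm_num]
  refine Real.log_le_log hnpos ?_
  rw [div_le_iff₀ (by positivity)] at hnc
  calc (n : ℝ) = n * 1 := (mul_one _).symm
    _ ≤ n * (n * c ^ 2) := by gcongr
    _ ≤ n * (n * x ^ 2) := by gcongr
    _ = (n * x) ^ 2 := by ring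

lemma walkLen_le {d n : ℕ} {φ : ℝ} (hd : 1 ≤ d) (hφ : 0 < φ) (hn : 3 ≤ n) :
    (walkLen d φ n : ℝ) ≤ (4 / gap d φ + 1) * Real.log n := by
  have := gap_pos hd hφ
  exact natCeil_le_of_one_le (by positivity) (one_le_log hn)

lemma phaseLen_le {d n : ℕ} {φ : ℝ} (hd : 1 ≤ d) (hφ : 0 < φ) (hn : 3 ≤ n) :
    (phaseLen d φ n : ℝ) ≤ (4 / gap d φ + 1) * 11 * d * Real.log n ^ 2 := by
  have h0 := gap_pos hd hφ
  have h1 := walkLen_le hd hφ hn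
  have hlog := one_le_log hn
  have h2 : (load n : ℝ) ≤ (10 + 1) * Real.log n :=
    natCeil_le_of_one_le (by norm_num) hlog
  rw [phaseLen]
  push_cast
  calc (walkLen d φ n : ℝ) * (load n * d)
      ≤ ((4 / gap d φ + 1) * Real.log n) * (((10 + 1) * Real.log n) * d) := by gcongr
    _ = _ := by ring

lemma mixLen_add_spreadLen_le {γ c x : ℝ} {n : ℕ} (hγ : 0 < γ) (hc : 0 < c) (hn : 3 ≤ n)
    (hnc : 1 / c ^ 2 ≤ n) (hx : c ≤ x) :
    ((mixLen γ n x + spreadLen γ n : ℕ) : ℝ) ≤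
      (1300 + 400 * γ) * (Real.log n * Real.log (n * x)) := by
  have hlog := one_le_log hn
  have h1 := log_le_two_mul_log hc (by omega) hnc hx
  have h2 : (spreadLen γ n : ℝ) ≤ (16 * (4 + γ) + 1) * Real.log n :=
    natCeil_le_of_one_le (by positivity) hlog
  have hpos : 0 ≤ Real.log (n * x) := by linarith
  have h3 := (Nat.ceil_lt_add_one (show 0 ≤ 4 * (135 + 33 * γ) * Real.log n +
    8 * Real.log (n * x) by positivity)).le
  push_cast
  rw [← mixLen] at h3
  set lam := Real.log n
  set Lam := Real.log (n * x)
  have h4 : lam ≤ 2 * (lam * Lam) := by nlinarith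
  have h5 : Lam ≤ lam * Lam := by nlinarith
  have h6 : γ * lam ≤ γ * (2 * (lam * Lam)) := by gcongr
  have h7 : 0 ≤ γ * (lam * Lam) := by positivity
  linarith

end Parameters

/-- The probability bound for the parameters above. -/
lemma one_sub_rpow_le_successProb {W κ : Type*} [Fintype W] {G : SimpleGraph W} {d n : ℕ}
    {φ c γ : ℝ} (hd : 1 ≤ d) (hφ : 0 < φ) (hc : 0 < c) (hγ : 0 < γ) (hn : 128 ≤ n)
    (hn' : 4 / gap d φ + 1 ≤ n) (hnc : 1 / c ^ 2 ≤ n)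
    (hG : IsExpander φ G) (hdeg : ∀ u, deg G u ≤ d) (hW : Fintype.card W ≤ n) {ID : W → ℕ}
    (hID : Function.Injective ID) {R : Set ℝ}
    (hR : ∀ a ∈ R, ∀ b ∈ R, a ≠ b → c ≤ |a - b|) {s : W → κ → ℝ} {x : ℝ} (hx : c ≤ x)
    (hs : ∀ u j, |s u j| ≤ x) (hagg : ∀ b, ∀ j, (∑ u, part b (s u)) j ∈ R) :
    1 - (n : ℝ) ^ (-γ) ≤ successProb G ID R d (walkLen d φ n) (phaseLen d φ n)
      (mixLen γ n x + spreadLen γ n) s := by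
  classical
  have hne : Nonempty W := hG.1.nonempty
  have hm : (0 : ℝ) < Fintype.card W := by exact_mod_cast Fintype.card_pos
  have hmn : (Fintype.card W : ℝ) ≤ n := by exact_mod_cast hW
  have hnpos : (0 : ℝ) < n := hm.trans_le hmn
  have hxpos := hc.trans_le hx
  have h := goodPhase_of_isExpander hd hφ hn hn' hG hdeg hW
  have hδ : Fintype.card W * (x * (c / (2 * n ^ 2 * x * 2 ^ spreadLen γ n))) ≤
      c / 2 * (1 / Fintype.card W / 2 ^ spreadLen γ n) := by
    calc (Fintype.card W : ℝ) * (x * (c / (2 * n ^ 2 * x * 2 ^ spreadLen γ n)))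
        = c / 2 * (Fintype.card W / n ^ 2 / 2 ^ spreadLen γ n) := by field_simp
      _ ≤ _ := by
        gcongr ?_ * (?_ / ?_)
        rw [div_le_div_iff₀ (by positivity) hm, one_mul, sq]
        gcongr
  refine le_trans ?_ (one_sub_le_successProb h hID hc hR hxpos hs hagg (T := mixLen γ n x)
    (by positivity) hδ)
  linarith [failure_le hγ hc (by omega) hnc hx hm.le hmn]

/-! ### Message sizes -/

section Bits

variable {W : Type*} [Fintype W]

lemma sum_abs_pushSum_le (dest : ℕ → W → W) (init : W → ℝ) (t : ℕ) :
    ∑ v, |pushSum dest init t v| ≤ ∑ v, |init v| := by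
  classical
  induction t with
  | zero => exact le_rfl
  | succ t ih =>
    refine le_trans ?_ ih
    rw [← sum_pushStep (dest t) fun v => |pushSum dest init t v|]
    refine Finset.sum_le_sum fun v _ => ?_
    rw [pushSum_succ, pushStep_real, pushStep_real, abs_div, abs_two]
    refine div_le_div_of_nonneg_right ?_ zero_le_two
    refine (abs_add_le _ _).trans (add_le_add le_rfl ((Finset.abs_sum_le_sum_abs _ _).trans ?_))
    refine Finset.sum_le_sum fun u _ => ?_
    split_ifs <;> simp

/-- Every phase adds one binary digit after the point. -/
lemma exists_int_pushSum (dest : ℕ → W → W) (init : W → ℤ) (t : ℕ) (v : W) :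
    ∃ z : ℤ, pushSum dest (fun u => (init u : ℝ)) t v * 2 ^ t = z := by
  classical
  induction t generalizing v with
  | zero => exact ⟨init v, by simp [pushSum]⟩
  | succ t ih =>
    choose z hz using ih
    refine ⟨z v + ∑ u, if dest t u = v then z u else 0, ?_⟩
    rw [pushSum_succ, pushStep_real, pow_succ]
    push_cast
    rw [← hz, show ∀ a b : ℝ, (a + b) / 2 * (2 ^ t * 2) = a * 2 ^ t + b * 2 ^ t by intros; ring,
      Finset.sum_mul]
    congr 1
    refine Finset.sum_congr rfl fun u _ => ?_
    split_ifs
    · exact hz u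
    · simp

lemma fitsBits_half_pushSum (dest : ℕ → W → W) (init : W → ℤ) {Ts B t : ℕ} (ht : t < Ts)
    (hB : ∑ v, |(init v : ℝ)| ≤ 2 ^ B) (v : W) :
    FitsBits (Ts + B) (1 / 2 * pushSum dest (fun u => (init u : ℝ)) t v) := by
  obtain ⟨z, hz⟩ := exists_int_pushSum dest init t v
  refine ⟨z, t + 1, by omega, ?_, ?_⟩
  · have h1 : |pushSum dest (fun u => (init u : ℝ)) t v| ≤ 2 ^ B :=
      (Finset.single_le_sum (f := fun v => |pushSum dest (fun u => (init u : ℝ)) t v|)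
        (fun _ _ => abs_nonneg _) (Finset.mem_univ v)).trans
        ((sum_abs_pushSum_le dest _ t).trans hB)
    have h2 : |(z : ℝ)| ≤ 2 ^ (Ts + B) := by
      rw [← hz, abs_mul, abs_of_pos (a := (2 : ℝ) ^ t) (by positivity)]
      calc _ ≤ (2 : ℝ) ^ B * 2 ^ t := by gcongr
        _ = 2 ^ (B + t) := (pow_add _ _ _).symm
        _ ≤ 2 ^ (Ts + B) := pow_le_pow_right₀ (by norm_num) (by omega)
    exact_mod_cast h2
  · rw [← hz, pow_succ]
    field_simp

lemma exists_int_part {κ : Type*} (b : Bool) {y : κ → ℝ} {j : κ} {z : ℤ} (h : y j = z) :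
    ∃ z' : ℤ, part b y j = z' := by
  cases b
  · exact ⟨min z 0, by simp [part, h]⟩
  · exact ⟨max z 0, by simp [part, h]⟩

lemma messagesFit {k : ℕ} (G : SimpleGraph W) {ID : W → ℕ} (hID : Function.Injective ID)
    (d ℓ Tp : ℕ) {Ts B : ℕ} {s : W → Fin k → ℝ} (hs : ∀ u j, ∃ z : ℤ, s u j = z) {x : ℝ}
    (hx : ∀ u j, |s u j| ≤ x) (hB : Fintype.card W * x ≤ 2 ^ B) :
    MessagesFit G ID d ℓ Tp Ts s (Ts + B) := by
  intro ω b t u ht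
  have hne : Nonempty W := ⟨u⟩
  refine ⟨?_, fun j => ?_⟩
  · have h1 : initWeight ID = fun u => (((if ∀ v, ID u ≤ ID v then 1 else 0 : ℤ)) : ℝ) := by
      funext u
      simp [initWeight]
    rw [weight, h1]
    refine fitsBits_half_pushSum _ _ ht ?_ u
    simp only [← congrFun h1, abs_of_nonneg (initWeight_nonneg ID _), sum_initWeight hID]
    exact one_le_pow₀ (by norm_num)
  · choose z hz using fun v => (hs v j).elim fun z hz => exists_int_part b hz
    rw [vector, pushSum_apply]
    simp only [hz]
    refine fitsBits_half_pushSum _ _ ht ?_ u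
    refine le_trans ?_ hB
    calc ∑ v, |(z v : ℝ)| ≤ ∑ _v : W, x := Finset.sum_le_sum fun v _ => by
          rw [← hz v]
          exact (abs_part_le b (s v) j).trans (hx v j)
      _ = Fintype.card W * x := by simp

end Bits

/-! ### Graph sketches -/

section SketchBounds

lemma abs_incidence_le {V : Type*} {N : ℕ} (G : SimpleGraph V) (ID : V → Fin N) (v : V)
    (p : IDPair N) : |(incidence G ID v p : ℝ)| ≤ 1 := by
  rw [incidence]
  split_ifs <;> simp

lemma abs_sketch_le {V : Type*} {N k a : ℕ} {M : Matrix (Fin k) (IDPair N) ℤ} {C q : ℝ}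
    (hM : ∀ i p, |(M i p : ℝ)| ≤ C * (N : ℝ) ^ a) (hN : (N : ℝ) ≤ q) (G : SimpleGraph V)
    (ID : V → Fin N) (v : V) (j : Fin k) : |sketch M G ID v j| ≤ |C| * q ^ (a + 2) := by
  have h1 : ∀ p, |(M j p : ℝ) * (incidence G ID v p : ℝ)| ≤ |C| * (N : ℝ) ^ a := fun p => by
    rw [abs_mul]
    calc _ ≤ |(M j p : ℝ)| * 1 := by gcongr; exact abs_incidence_le G ID v p
      _ ≤ C * (N : ℝ) ^ a := by rw [mul_one]; exact hM j p
      _ ≤ |C| * (N : ℝ) ^ a := by gcongr; exact le_abs_self C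
  have h2 : (Fintype.card (IDPair N) : ℝ) ≤ (N : ℝ) ^ 2 := by
    have := Fintype.card_subtype_le fun p : Fin N × Fin N => p.1 < p.2
    rw [Fintype.card_prod, Fintype.card_fin, ← sq] at this
    exact_mod_cast this
  calc |sketch M G ID v j| = |∑ p, (M j p : ℝ) * (incidence G ID v p : ℝ)| := by
        simp [sketch, Matrix.mulVec, dotProduct]
    _ ≤ ∑ p : IDPair N, |C| * (N : ℝ) ^ a :=
        (Finset.abs_sum_le_sum_abs _ _).trans (Finset.sum_le_sum fun p _ => h1 p)
    _ = Fintype.card (IDPair N) * (|C| * (N : ℝ) ^ a) := by simp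
    _ ≤ (N : ℝ) ^ 2 * (|C| * (N : ℝ) ^ a) := by gcongr
    _ = |C| * (N : ℝ) ^ (a + 2) := by ring
    _ ≤ _ := by gcongr

/-- A bound for the entries of the sketch vectors in terms of `n`: the matrix has at most `N ^ 2`
columns and entries of size at most `|C| * N ^ a`, where `N ≤ n ^ c₀`. The summand `1` makes it at
least the distance of legal values. -/
noncomputable def entryBound (C c₀ : ℝ) (a n : ℕ) : ℝ := 1 + |C| * ((n : ℝ) ^ c₀) ^ (a + 2)

lemma one_le_entryBound (C c₀ : ℝ) (a n : ℕ) : 1 ≤ entryBound C c₀ a n := by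
  have : 0 ≤ |C| * ((n : ℝ) ^ c₀) ^ (a + 2) := by positivity
  rw [entryBound]
  linarith

lemma log_mul_entryBound_le (C c₀ : ℝ) (a : ℕ) {n : ℕ} (hn : 3 ≤ n) :
    Real.log (n * entryBound C c₀ a n) ≤ (1 + |C| + |c₀| * (a + 2)) * Real.log n := by
  have hlog := one_le_log hn
  have hnpos : (0 : ℝ) < n := by exact_mod_cast (by omega : 0 < n)
  set lam := Real.log n with hlam
  have h1 : ((n : ℝ) ^ c₀) ^ (a + 2) ≤ Real.exp (|c₀| * (a + 2) * lam) := by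
    rw [Real.rpow_def_of_pos hnpos, ← Real.exp_nat_mul]
    refine Real.exp_le_exp.2 ?_
    push_cast
    have := mul_le_mul_of_nonneg_right (le_abs_self c₀) (show 0 ≤ (a + 2) * lam by positivity)
    linarith
  have h2 : 1 ≤ Real.exp (|c₀| * (a + 2) * lam) := Real.one_le_exp (by positivity)
  have h3 : entryBound C c₀ a n ≤ Real.exp |C| * Real.exp (|c₀| * (a + 2) * lam) := by
    calc entryBound C c₀ a n ≤ Real.exp (|c₀| * (a + 2) * lam) +
          |C| * Real.exp (|c₀| * (a + 2) * lam) := by rw [entryBound]; gcongr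
      _ = (|C| + 1) * Real.exp (|c₀| * (a + 2) * lam) := by ring
      _ ≤ _ := by gcongr; exact Real.add_one_le_exp _
  have h4 := one_le_entryBound C c₀ a n
  rw [Real.log_mul hnpos.ne' (by linarith)]
  have h5 := Real.log_le_log (by linarith) h3
  rw [Real.log_mul (Real.exp_pos _).ne' (Real.exp_pos _).ne', Real.log_exp, Real.log_exp] at h5
  have h6 : |C| ≤ |C| * lam := le_mul_of_one_le_right (abs_nonneg C) hlog
  linarith

/-- A number of binary digits that suffices for the sums of the absolute values of the entries. -/
noncomputable def sumBits (C c₀ : ℝ) (a n : ℕ) : ℕ := ⌈2 * Real.log (n * entryBound C c₀ a n)⌉₊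

lemma mul_entryBound_le_two_pow (C c₀ : ℝ) (a : ℕ) {n : ℕ} (hn : 1 ≤ n) :
    n * entryBound C c₀ a n ≤ 2 ^ sumBits C c₀ a n := by
  have h1 := one_le_entryBound C c₀ a n
  have hnpos : (0 : ℝ) < n := by exact_mod_cast hn
  rw [← Real.log_le_log_iff (by positivity) (by positivity), Real.log_pow]
  have h2 : 2 * Real.log (n * entryBound C c₀ a n) ≤ sumBits C c₀ a n := Nat.le_ceil _
  have h3 := mul_le_mul_of_nonneg_left half_le_log_two
    (Nat.cast_nonneg (α := ℝ) (sumBits C c₀ a n))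
  linarith

lemma one_le_abs_sub_of_mem_range_intCast : ∀ a ∈ Set.range ((↑) : ℤ → ℝ),
    ∀ b ∈ Set.range ((↑) : ℤ → ℝ), a ≠ b → 1 ≤ |a - b| := by
  rintro _ ⟨a, rfl⟩ _ ⟨b, rfl⟩ hab
  have : 1 ≤ |a - b| := Int.one_le_abs (sub_ne_zero.2 fun h => hab (by rw [h]))
  exact_mod_cast this

end SketchBounds

end GossipSketch

open GossipSketch in
theorem mainTheorem3 :
    -- the general lemma
    (∀ (d : ℕ) (φ c γ : ℝ), 1 ≤ d → 0 < φ → 0 < c → 0 < γ →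
      ∃ (K : ℝ) (n₀ : ℕ) (ℓ Tp : ℕ → ℕ) (Ts : ℕ → ℝ → ℕ),
        (∀ n, n₀ ≤ n →
          (ℓ n : ℝ) ≤ K * Real.log n ∧
          (Tp n : ℝ) ≤ K * Real.log n ^ 2 ∧
          ∀ x : ℝ, c ≤ x →
            (Ts n x : ℝ) ≤ K * (Real.log n * Real.log (n * x)) ∧
            ((Ts n x * Tp n : ℕ) : ℝ) ≤ K * (Real.log n ^ 3 * Real.log (n * x))) ∧
        ∀ (n : ℕ) (V : Type) [Fintype V], n₀ ≤ n → Fintype.card V ≤ n →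
        ∀ (ID : V → ℕ) (S : Finset V) (G' : SimpleGraph S) (k : ℕ) (s : S → Fin k → ℝ)
          (R : Set ℝ) (L U x : ℝ),
          Function.Injective ID →
          IsExpander φ G' → (∀ u, deg G' u ≤ d) →
          (∀ a ∈ R, ∀ b ∈ R, a ≠ b → c ≤ |a - b|) →
          0 ∈ R → L ≤ 0 → 0 ≤ U → U - L = x → c ≤ x →
          (∀ u j, s u j ∈ R ∧ L ≤ s u j ∧ s u j ≤ U) →
          (∀ b, ∀ j, (∑ u, part b (s u)) j ∈ R) →
          1 - (n : ℝ) ^ (-γ) ≤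
            successProb G' (fun u => ID u) R d (ℓ n) (Tp n) (Ts n x) s) ∧
    -- the corollary
    (∀ (d a : ℕ) (φ c₀ C γ : ℝ), 1 ≤ d → 0 < φ → 0 < γ →
      ∃ (K : ℝ) (n₀ : ℕ) (ℓ Tp Ts B : ℕ → ℕ),
        (∀ n, n₀ ≤ n →
          (ℓ n : ℝ) ≤ K * Real.log n ∧
          (Tp n : ℝ) ≤ K * Real.log n ^ 2 ∧
          (Ts n : ℝ) ≤ K * Real.log n ^ 2 ∧
          ((Ts n * Tp n : ℕ) : ℝ) ≤ K * Real.log n ^ 4 ∧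
          (B n : ℝ) ≤ K * Real.log n ^ 2) ∧
        ∀ (n : ℕ) (V : Type) [Fintype V], n₀ ≤ n → Fintype.card V ≤ n →
        ∀ (N : ℕ) (ID : V → Fin N) (G : SimpleGraph V) (S : Finset V) (G' : SimpleGraph S)
          (k : ℕ) (M : Matrix (Fin k) (IDPair N) ℤ),
          Function.Injective ID → (N : ℝ) ≤ (n : ℝ) ^ c₀ →
          IsExpander φ G' → (∀ u, deg G' u ≤ d) →
          (∀ i p, |(M i p : ℝ)| ≤ C * (N : ℝ) ^ a) →
          1 - (n : ℝ) ^ (-γ) ≤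
            successProb G' (fun u => (ID u : ℕ)) (Set.range ((↑) : ℤ → ℝ)) d (ℓ n) (Tp n) (Ts n)
              (fun u => sketch M G ID u) ∧
          MessagesFit G' (fun u => (ID u : ℕ)) d (ℓ n) (Tp n) (Ts n)
            (fun u => sketch M G ID u) (B n)) := by
  refine ⟨fun d φ c γ hd hφ hc hγ => ?_, fun d a φ c₀ C γ hd hφ hγ => ?_⟩
  · have hβ := gap_pos hd hφ
    set K₁ := 4 / gap d φ + 1
    set K₂ := K₁ * 11 * d
    set K₃ := 1300 + 400 * γ
    have hK₁ : 0 ≤ K₁ := by positivity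
    have hK₂ : 0 ≤ K₂ := by positivity
    have hK₃ : 0 ≤ K₃ := by positivity
    have hK₂₃ := mul_nonneg hK₃ hK₂
    refine ⟨K₁ + K₂ + K₃ + K₃ * K₂, max 128 (max ⌈K₁⌉₊ ⌈1 / c ^ 2⌉₊), walkLen d φ, phaseLen d φ,
      fun n x => mixLen γ n x + spreadLen γ n, fun n hn => ?_, ?_⟩
    · obtain ⟨hn, -, hnc⟩ : 128 ≤ n ∧ K₁ ≤ n ∧ 1 / c ^ 2 ≤ n := by
        simpa [Nat.ceil_le] using hn
      have hlog := one_le_log (show 3 ≤ n by omega)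
      have hTp := phaseLen_le hd hφ (show 3 ≤ n by omega)
      refine ⟨(walkLen_le hd hφ (by omega)).trans ?_, hTp.trans ?_, fun x hx => ?_⟩
      · exact mul_le_mul_of_nonneg_right (by linarith) (by positivity)
      · exact mul_le_mul_of_nonneg_right (by linarith) (by positivity)
      have hTs := mixLen_add_spreadLen_le hγ hc (show 3 ≤ n by omega) hnc hx
      have hLam : 0 ≤ Real.log (n * x) := by
        linarith [log_le_two_mul_log hc (show 1 ≤ n by omega) hnc hx]
      refine ⟨hTs.trans ?_, ?_⟩
      · exact mul_le_mul_of_nonneg_right (by linarith) (by positivity)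
      · rw [Nat.cast_mul]
        calc _ ≤ (K₃ * (Real.log n * Real.log (n * x))) * (K₂ * Real.log n ^ 2) := by gcongr
          _ = K₃ * K₂ * (Real.log n ^ 3 * Real.log (n * x)) := by ring
          _ ≤ _ := mul_le_mul_of_nonneg_right (by linarith) (by positivity)
    · intro n V _ hn hV ID S G' k s R L U x hID hG' hdeg hR h0 hL hU hLU hx hs hagg
      obtain ⟨hn, hn', hnc⟩ : 128 ≤ n ∧ K₁ ≤ n ∧ 1 / c ^ 2 ≤ n := by
        simpa [Nat.ceil_le] using hn
      refine one_sub_rpow_le_successProb hd hφ hc hγ hn hn' hnc hG' hdeg ?_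
        (hID.comp Subtype.val_injective) hR hx (fun u j => ?_) hagg
      · rw [Fintype.card_coe]
        exact (Finset.card_le_univ S).trans hV
      · rw [abs_le]
        constructor <;> linarith [(hs u j).2.1, (hs u j).2.2]
  · have hβ := gap_pos hd hφ
    set K₁ := 4 / gap d φ + 1
    set K₂ := K₁ * 11 * d
    set K₃ := 1300 + 400 * γ
    set K₄ := 1 + |C| + |c₀| * (a + 2)
    have hK₁ : 0 ≤ K₁ := by positivity
    have hK₂ : 0 ≤ K₂ := by positivity
    have hK₃ : 0 ≤ K₃ := by positivity
    have hK₄ : 0 ≤ K₄ := by positivity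
    have hK₃₄ := mul_nonneg hK₃ hK₄
    have hK₂₃₄ := mul_nonneg hK₃₄ hK₂
    let Ts : ℕ → ℕ := fun n => mixLen γ n (entryBound C c₀ a n) + spreadLen γ n
    refine ⟨K₁ + K₂ + (K₃ * K₄ + (2 * K₄ + 1)) + K₃ * K₄ * K₂, max 128 ⌈K₁⌉₊, walkLen d φ,
      phaseLen d φ, Ts, fun n => Ts n + sumBits C c₀ a n, fun n hn => ?_, ?_⟩
    · obtain ⟨hn, -⟩ : 128 ≤ n ∧ K₁ ≤ n := by simpa [Nat.ceil_le] using hn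
      have hn3 : 3 ≤ n := by omega
      have hn1 : (1 : ℝ) / 1 ^ 2 ≤ n := by norm_num; omega
      have hlog := one_le_log hn3
      have hTp := phaseLen_le hd hφ hn3
      have hX := one_le_entryBound C c₀ a n
      have hLam := log_mul_entryBound_le C c₀ a hn3
      have hLam0 : 0 ≤ Real.log (n * entryBound C c₀ a n) := by
        linarith [log_le_two_mul_log one_pos (show 1 ≤ n by omega) hn1 hX]
      have hTs : (Ts n : ℝ) ≤ K₃ * K₄ * Real.log n ^ 2 := by
        refine (mixLen_add_spreadLen_le hγ one_pos hn3 hn1 hX).trans ?_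
        calc _ ≤ K₃ * (Real.log n * (K₄ * Real.log n)) := by gcongr
          _ = _ := by ring
      have hB : (sumBits C c₀ a n : ℝ) ≤ (2 * K₄ + 1) * Real.log n ^ 2 := by
        have h1 := (Nat.ceil_lt_add_one (show 0 ≤ 2 * Real.log (n * entryBound C c₀ a n) by
          positivity)).le
        rw [← sumBits] at h1
        calc (sumBits C c₀ a n : ℝ) ≤ (2 * K₄ + 1) * Real.log n := by linarith
          _ ≤ (2 * K₄ + 1) * Real.log n ^ 2 := by
            gcongr
            exact le_self_pow₀ hlog two_ne_zero
      refine ⟨(walkLen_le hd hφ hn3).trans ?_, hTp.trans ?_, hTs.trans ?_, ?_, ?_⟩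
      · exact mul_le_mul_of_nonneg_right (by linarith) (by positivity)
      · exact mul_le_mul_of_nonneg_right (by linarith) (by positivity)
      · exact mul_le_mul_of_nonneg_right (by linarith) (by positivity)
      · rw [Nat.cast_mul]
        calc _ ≤ (K₃ * K₄ * Real.log n ^ 2) * (K₂ * Real.log n ^ 2) := by gcongr
          _ = K₃ * K₄ * K₂ * Real.log n ^ 4 := by ring
          _ ≤ _ := mul_le_mul_of_nonneg_right (by linarith) (by positivity)
      · rw [Nat.cast_add]
        calc _ ≤ K₃ * K₄ * Real.log n ^ 2 + (2 * K₄ + 1) * Real.log n ^ 2 := add_le_add hTs hB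
          _ = (K₃ * K₄ + (2 * K₄ + 1)) * Real.log n ^ 2 := by ring
          _ ≤ _ := mul_le_mul_of_nonneg_right (by linarith) (by positivity)
    · intro n V _ hn hV N ID G S G' k M hID hN hG' hdeg hM
      obtain ⟨hn, hn'⟩ : 128 ≤ n ∧ K₁ ≤ n := by simpa [Nat.ceil_le] using hn
      have hn1 : (1 : ℝ) / 1 ^ 2 ≤ n := by norm_num; omega
      have hcard : Fintype.card S ≤ n := by
        rw [Fintype.card_coe]
        exact (Finset.card_le_univ S).trans hV
      have hIDS : Function.Injective fun u : S => (ID u : ℕ) :=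
        Fin.val_injective.comp (hID.comp Subtype.val_injective)
      have hint : ∀ (u : S) j, ∃ z : ℤ, sketch M G ID u j = z := fun u j => ⟨_, rfl⟩
      have hbound : ∀ (u : S) j, |sketch M G ID u j| ≤ entryBound C c₀ a n := fun u j => by
        rw [entryBound]
        linarith [abs_sketch_le hM hN G ID u j]
      refine ⟨one_sub_rpow_le_successProb hd hφ one_pos hγ hn hn' hn1 hG' hdeg hcard hIDS
        one_le_abs_sub_of_mem_range_intCast (one_le_entryBound C c₀ a n) hbound fun b j => ?_,
        messagesFit G' hIDS d _ _ hint hbound ?_⟩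
      · choose z hz using fun u => (hint u j).elim fun z hz => exists_int_part b hz
        refine ⟨∑ u, z u, ?_⟩
        rw [Finset.sum_apply]
        push_cast
        exact Finset.sum_congr rfl fun u _ => (hz u).symm
      · refine le_trans ?_ (mul_entryBound_le_two_pow C c₀ a (show 1 ≤ n by omega))
        have := one_le_entryBound C c₀ a n
        gcongr
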